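/- Let $M$ be a $1$-connected complex manifold with a semi-simple CDV$\oplus$-structure. That is: $(M,\circ,g,e,\mathcal E)$ is a Frobenius manifold with Levi-Civita connection $\nabla$ and constant $d$ ($\mathcal L_{\mathcal E}g=(2-d)g$); $\kappa$ is a real structure on $T^{1,0}_M$ such that $h(X,Y)=g(X,\kappa Y)$ is a positive definite Hermitian metric, with Chern connection $D=D'+\bar\partial$; put $\Phi_XY=-X\circ Y$, $\Phi^\dagger_{\overline X}=\kappa\Phi_X\kappa$, $\mathcal U=\mathcal E\circ$, $\mathcal U^\dagger=\kappa\,\mathcal U\kappa$, $\mathcal V=\nabla\mathcal E-\frac{2-d}2\mathrm{Id}$ and $\mathcal Q=D_{\mathcal E}-\mathcal L_{\mathcal E}-\frac{2-d}2\mathrm{Id}$; these data satisfy the equations of a CV-structure, $$D\kappa=0,\quad D'(\Phi)=0,\quad D'\bar\partial+\bar\partial D'=-(\Phi\wedge\Phi^\dagger+\Phi^\dagger\wedge\Phi),$$ $$D'(\mathcal U)-[\Phi,\mathcal Q]+\Phi=0,\quad D'(\mathcal Q)+[\Phi,\mathcal U^\dagger]=0,\quad \mathcal Q+\kappa\mathcal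 Q\kappa=0,\quad g(\mathcal QX,Y)=-g(X,\mathcal QY);$$ and $\mathcal U$ has $\dim M$ pairwise distinct eigenvalues at each point of $M$. The structure is of Tate type if $\mathcal Q=0$. With $\pi:\mathbb C\times M\to M$ the projection and $z$ the coordinate on $\mathbb C$, let $\mathcal H_1$ be $\pi^*T^{1,0}_M$ with its usual holomorphic structure and the meromorphic connection $\widetilde\nabla=\nabla+d'_z+\frac1z\Phi+(\frac1z\mathcal U-\mathcal V)\frac{dz}z$, and let $\mathcal H_2$ be $\pi^*T^{1,0}_M$ with the holomorphic structure $\bar\partial+d''_z+z\Phi^\dagger$ and the meromorphic connection $\widetilde D=D'+d'_z+\frac1z\Phi+(\frac1z\mathcal U-\mathcal Q-z\,\mathcal U^\dagger)\frac{dz}z$. The structure is strongly potential if there is an isomorphism of holomorphic bundles $\phi:\mathcal H_1\to\mathcal H_2$ on $\mathbb C\times M$ with $\phi\widetilde\nabla=\widetilde D\phi$. (1) If $D'=\nabla$, then the structure is of Tate type and strongly potential. Let moreover $\boldsymbol u=(u^1,\dots,u^m):M\to\mathbb C^m$ be canonical coordinates (in the étale sense): $\boldsymbol u$ is holomorphic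 with bijective differential at each point, and the fields $e_i=\partial_{u^i}$ satisfy $e_i\circ e_j=\delta_{ij}e_i$ and $\mathcal E=\sum_k u^ke_k$. Then: (2) $D'=\nabla$ if and only if the structure is of Tate type and the canonical coordinates are $\nabla$-flat, i.e. $\nabla e_i=0$ for all $i$. (3) If $D'=\nabla$, then the isomorphisms $\phi:(\mathcal H_1,\widetilde\nabla)\to(\mathcal H_2,\widetilde D)$ are exactly those whose matrix in the frame $(e_i)$ is $$(\phi_{ij}(z,\boldsymbol u))_{m\times m}=\operatorname{diag}\bigl(c_1\exp(z\,\overline{u^1}),\dots,c_m\exp(z\,\overline{u^m})\bigr)$$ for some nonzero constants $c_1,\dots,c_m\in\mathbb C$. -/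

import Mathlib

open Bundle
open scoped Manifold ContDiff ComplexConjugate

namespace TTStar

noncomputable section

/-- The holomorphic tangent space of a complex manifold `M` modelled on `E`. As a complex vector
bundle it is identified with `T^{1,0} M`: the vector `v` stands for the `(1,0)`-vector
`(v - i J v) / 2`, where `J` is multiplication by `i` on the underlying real tangent space. -/
abbrev HTan (E : Type*) [NormedAddCommGroup E] [NormedSpace ℂ E]
    {M : Type*} [TopologicalSpace M] [ChartedSpace E M] (x : M) : Type _ :=
  TangentSpace 𝓘(ℂ, E) x

instance instContinuousSMulRealHTan (E : Type*) [NormedAddCommGroup E] [NormedSpace ℂ E]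
    {M : Type*} [TopologicalSpace M] [ChartedSpace E M] (x : M) :
    ContinuousSMul ℝ (HTan E x) :=
  inferInstanceAs (ContinuousSMul ℝ E)

section Sections

variable {E : Type*} [NormedAddCommGroup E] [NormedSpace ℂ E]
  {M : Type*} [TopologicalSpace M] [ChartedSpace E M] [IsManifold 𝓘(ℂ, E) ω M]

/-- The vector field `X` is holomorphic (on a neighbourhood of `x`). -/
def IsHolAt (X : ∀ x : M, HTan E x) (x : M) : Prop :=
  ContMDiffAt 𝓘(ℂ, E) (𝓘(ℂ, E).prod 𝓘(ℂ, E)) ω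
    (fun y => TotalSpace.mk' E (E := (HTan E : M → Type _)) y (X y)) x

/-- The section `X` of `T^{1,0} M` is `C^∞` (in the real sense) at `x`. -/
def IsSmoothAt (X : ∀ x : M, HTan E x) (x : M) : Prop :=
  ContMDiffAt 𝓘(ℝ, E) (𝓘(ℝ, E).prod 𝓘(ℝ, E)) ∞
    (fun y => TotalSpace.mk' E (E := (HTan E : M → Type _)) y (X y)) x

/-- A section of the pull-back of the tangent bundle to `ℂ × M`, holomorphic near `(z, x)`. -/
def IsHolAtProd (s : ℂ → ∀ x : M, HTan E x) (z : ℂ) (x : M) : Prop :=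
  ContMDiffAt (𝓘(ℂ, ℂ).prod 𝓘(ℂ, E)) (𝓘(ℂ, E).prod 𝓘(ℂ, E)) ω
    (fun p : ℂ × M => TotalSpace.mk' E (E := (HTan E : M → Type _)) p.2 (s p.1 p.2)) (z, x)

/-- A section of the pull-back of the tangent bundle to `ℂ × M` which is `C^∞` at `(z, x)`. -/
def IsSmoothAtProd (s : ℂ → ∀ x : M, HTan E x) (z : ℂ) (x : M) : Prop :=
  ContMDiffAt (𝓘(ℝ, ℂ).prod 𝓘(ℝ, E)) (𝓘(ℝ, E).prod 𝓘(ℝ, E)) ∞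
    (fun p : ℂ × M => TotalSpace.mk' E (E := (HTan E : M → Type _)) p.2 (s p.1 p.2)) (z, x)

/-- For a connection `D` on the `C^∞` bundle `T^{1,0} M` (so that `D σ x v` is the derivative of
`σ` along the real tangent vector `v`), the derivative `D'_v σ` along the `(1,0)`-vector
`(v - i J v) / 2`. -/
def dPrime (D : CovariantDerivative 𝓘(ℝ, E) E (HTan E : M → Type _))
    (σ : ∀ x : M, HTan E x) (x : M) (v : HTan E x) : HTan E x :=
  (1 / 2 : ℂ) • (D σ x v - Complex.I • D σ x (Complex.I • v : HTan E x))

/-- The derivative `D''_{v̄} σ` along the `(0,1)`-vector `(v + i J v) / 2`. -/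
def dSecond (D : CovariantDerivative 𝓘(ℝ, E) E (HTan E : M → Type _))
    (σ : ∀ x : M, HTan E x) (x : M) (v : HTan E x) : HTan E x :=
  (1 / 2 : ℂ) • (D σ x v + Complex.I • D σ x (Complex.I • v : HTan E x))

/-- The Wirtinger derivative `∂/∂z` of a function on `ℂ`. -/
def partialZ (f : ℂ → E) (z : ℂ) : E :=
  (1 / 2 : ℂ) • (fderiv ℝ f z 1 - Complex.I • fderiv ℝ f z Complex.I)

/-- The Wirtinger derivative `∂/∂z̄` of a function on `ℂ`. -/
def partialZBar (f : ℂ → E) (z : ℂ) : E :=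
  (1 / 2 : ℂ) • (fderiv ℝ f z 1 + Complex.I • fderiv ℝ f z Complex.I)

/-- `∂s/∂z` for a section `s` of the pull-back of the tangent bundle to `ℂ × M`. -/
def partialZSec (s : ℂ → ∀ x : M, HTan E x) (z : ℂ) (x : M) : HTan E x :=
  partialZ (E := E) (fun w => s w x) z

/-- `∂s/∂z̄` for a section `s` of the pull-back of the tangent bundle to `ℂ × M`. -/
def partialZBarSec (s : ℂ → ∀ x : M, HTan E x) (z : ℂ) (x : M) : HTan E x :=
  partialZBar (E := E) (fun w => s w x) z

end Sections

/-- The conjugate `κ A κ` of an endomorphism by an antilinear map. -/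
def conjEnd {V : Type*} [AddCommGroup V] [Module ℂ V] (κ : V →ₛₗ[starRingEnd ℂ] V)
    (A : V →ₗ[ℂ] V) : V →ₗ[ℂ] V :=
  κ.comp (A.comp κ)

/-- A Frobenius manifold `(M, ∘, g, e, 𝓔)` with its Levi-Civita connection `∇`. -/
structure FrobeniusManifold (E : Type*) [NormedAddCommGroup E] [NormedSpace ℂ E]
    (M : Type*) [TopologicalSpace M] [ChartedSpace E M] [IsManifold 𝓘(ℂ, E) ω M] where
  /-- the metric `g` -/
  metric : ∀ x : M, HTan E x →ₗ[ℂ] HTan E x →ₗ[ℂ] ℂ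
  /-- the multiplication `∘` -/
  mul : ∀ x : M, HTan E x →ₗ[ℂ] HTan E x →ₗ[ℂ] HTan E x
  /-- the unit field `e` -/
  unit : ∀ x : M, HTan E x
  /-- the Euler field `𝓔` -/
  euler : ∀ x : M, HTan E x
  /-- the constant `d` -/
  d : ℂ
  /-- the Levi-Civita connection, acting on holomorphic vector fields -/
  nabla : CovariantDerivative 𝓘(ℂ, E) E (HTan E : M → Type _)
  metric_holomorphic : ∀ (x : M) (X Y : ∀ x : M, HTan E x), IsHolAt X x → IsHolAt Y x →
    ContMDiffAt 𝓘(ℂ, E) 𝓘(ℂ, ℂ) ω (fun y => metric y (X y) (Y y)) x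
  metric_symm : ∀ (x : M) (v w : HTan E x), metric x v w = metric x w v
  metric_nondegenerate : ∀ (x : M) (v : HTan E x), (∀ w, metric x v w = 0) → v = 0
  mul_holomorphic : ∀ (x : M) (X Y : ∀ x : M, HTan E x), IsHolAt X x → IsHolAt Y x →
    IsHolAt (fun y => mul y (X y) (Y y)) x
  mul_comm : ∀ (x : M) (v w : HTan E x), mul x v w = mul x w v
  mul_assoc : ∀ (x : M) (v w t : HTan E x), mul x (mul x v w) t = mul x v (mul x w t)
  unit_holomorphic : ∀ x : M, IsHolAt unit x
  unit_mul : ∀ (x : M) (v : HTan E x), mul x (unit x) v = v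
  metric_mul : ∀ (x : M) (v w t : HTan E x), metric x (mul x v w) t = metric x v (mul x w t)
  euler_holomorphic : ∀ x : M, IsHolAt euler x
  /-- `∇` is a holomorphic connection -/
  nabla_holomorphic : ∀ (x : M) (X Y : ∀ x : M, HTan E x), IsHolAt X x → IsHolAt Y x →
    IsHolAt (fun y => nabla Y y (X y)) x
  /-- `∇` is torsion-free -/
  nabla_torsion : ∀ (x : M) (X Y : ∀ x : M, HTan E x), IsHolAt X x → IsHolAt Y x →
    nabla Y x (X x) - nabla X x (Y x) = VectorField.mlieBracket 𝓘(ℂ, E) X Y x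
  /-- `∇ g = 0` -/
  nabla_metric : ∀ (x : M) (X Y : ∀ x : M, HTan E x), IsHolAt X x → IsHolAt Y x →
    ∀ v : HTan E x, mvfderiv 𝓘(ℂ, E) (fun y => metric y (X y) (Y y)) x v =
      metric x (nabla X x v) (Y x) + metric x (X x) (nabla Y x v)
  /-- `∇` is flat -/
  nabla_flat : ∀ (x : M) (X Y Z : ∀ x : M, HTan E x),
    IsHolAt X x → IsHolAt Y x → IsHolAt Z x →
    nabla (fun y => nabla Z y (Y y)) x (X x) - nabla (fun y => nabla Z y (X y)) x (Y x) =
      nabla Z x (VectorField.mlieBracket 𝓘(ℂ, E) X Y x)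
  /-- potentiality: `(∇_X ∘)(Y, Z)` is symmetric in all three arguments -/
  nabla_mul_symm : ∀ (x : M) (X Y Z : ∀ x : M, HTan E x),
    IsHolAt X x → IsHolAt Y x → IsHolAt Z x →
    nabla (fun y => mul y (Y y) (Z y)) x (X x)
        - mul x (nabla Y x (X x)) (Z x) - mul x (Y x) (nabla Z x (X x)) =
      nabla (fun y => mul y (X y) (Z y)) x (Y x)
        - mul x (nabla X x (Y x)) (Z x) - mul x (X x) (nabla Z x (Y x))
  /-- the unit field is flat -/
  nabla_unit : ∀ x : M, nabla unit x = 0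
  /-- `𝓛_𝓔 ∘ = ∘` -/
  lie_euler_mul : ∀ (x : M) (X Y : ∀ x : M, HTan E x), IsHolAt X x → IsHolAt Y x →
    VectorField.mlieBracket 𝓘(ℂ, E) euler (fun y => mul y (X y) (Y y)) x
        - mul x (VectorField.mlieBracket 𝓘(ℂ, E) euler X x) (Y x)
        - mul x (X x) (VectorField.mlieBracket 𝓘(ℂ, E) euler Y x) =
      mul x (X x) (Y x)
  /-- `𝓛_𝓔 g = (2 - d) g` -/
  lie_euler_metric : ∀ (x : M) (X Y : ∀ x : M, HTan E x), IsHolAt X x → IsHolAt Y x →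
    mvfderiv 𝓘(ℂ, E) (fun y => metric y (X y) (Y y)) x (euler x)
        - metric x (VectorField.mlieBracket 𝓘(ℂ, E) euler X x) (Y x)
        - metric x (X x) (VectorField.mlieBracket 𝓘(ℂ, E) euler Y x) =
      (2 - d) * metric x (X x) (Y x)

namespace FrobeniusManifold

variable {E : Type*} [NormedAddCommGroup E] [NormedSpace ℂ E]
  {M : Type*} [TopologicalSpace M] [ChartedSpace E M] [IsManifold 𝓘(ℂ, E) ω M]
  (F : FrobeniusManifold E M)

/-- The Higgs field: `Φ_v w = - v ∘ w`. -/
def higgs (x : M) (v : HTan E x) : HTan E x →ₗ[ℂ] HTan E x := -(F.mul x v)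

/-- `𝓤`, the multiplication by the Euler field. -/
def U (x : M) : HTan E x →ₗ[ℂ] HTan E x := F.mul x (F.euler x)

/-- `𝓥 = ∇𝓔 - (2 - d)/2 · Id`. -/
def V (x : M) : HTan E x →ₗ[ℂ] HTan E x :=
  (F.nabla F.euler x : HTan E x →ₗ[ℂ] HTan E x) - ((2 - F.d) / 2) • LinearMap.id

/-- Semi-simplicity: the multiplication by `𝓔` has `dim M` distinct eigenvalues at each point. -/
def IsSemisimple : Prop :=
  ∀ x : M, ∃ μ : Fin (Module.finrank ℂ E) → ℂ, Function.Injective μ ∧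
    ∀ i, Module.End.HasEigenvalue (F.U x : Module.End ℂ (HTan E x)) (μ i)

/-- Canonical coordinates (global on `M`, in the étale sense), with their coordinate frame
`e_i = ∂/∂u^i`. -/
structure CanonicalCoordinates (m : ℕ) where
  /-- the coordinate functions `(u^1, …, u^m)` -/
  u : M → Fin m → ℂ
  /-- the fields `e_i = ∂/∂u^i` -/
  frame : Fin m → ∀ x : M, HTan E x
  u_holomorphic : ContMDiff 𝓘(ℂ, E) 𝓘(ℂ, Fin m → ℂ) ω u
  u_etale : ∀ x : M, Function.Bijective (mvfderiv 𝓘(ℂ, E) u x)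
  frame_dual : ∀ (i : Fin m) (x : M), mvfderiv 𝓘(ℂ, E) u x (frame i x) = Pi.single i 1
  frame_mul : ∀ (i j : Fin m) (x : M),
    F.mul x (frame i x) (frame j x) = if i = j then frame i x else 0
  euler_eq : ∀ x : M, F.euler x = ∑ k, u x k • frame k x

/-- The canonical coordinates are `∇`-flat: `∇ ∂/∂u^i = 0` for all `i`. -/
def CanonicalCoordinates.IsFlat {F : FrobeniusManifold E M} {m : ℕ}
    (c : F.CanonicalCoordinates m) : Prop :=
  ∀ (i : Fin m) (x : M), F.nabla (c.frame i) x = 0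

/-- The structure connection `∇~` of the Frobenius manifold on the holomorphic bundle
`𝓗₁ = π^* T_M`, in the direction `∂_z`, at a point with `z ≠ 0`. -/
def nablaTildeZ (s : ℂ → ∀ x : M, HTan E x) (z : ℂ) (x : M) : HTan E x :=
  partialZSec s z x
    + z⁻¹ • (z⁻¹ • F.U x (s z x) - F.V x (s z x))

/-- The structure connection `∇~` of the Frobenius manifold in the direction `v`, tangent to `M`,
at a point with `z ≠ 0`. -/
def nablaTilde (s : ℂ → ∀ x : M, HTan E x) (z : ℂ) (x : M) (v : HTan E x) : HTan E x :=
  F.nabla (s z) x v + z⁻¹ • F.higgs x v (s z x)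

end FrobeniusManifold

/-- A CDV-structure: a Frobenius manifold with a real structure `κ` on `T^{1,0} M` such that, with
`h(v, w) = g(v, κ w)`, `D` the Chern connection of `h`, `Φ_v = - v ∘`, `𝓤 = 𝓔 ∘` and
`𝓠 = D_𝓔 - 𝓛_𝓔 - (2 - d)/2 · Id`, the data form a CV-structure. -/
structure CDVStructure (E : Type*) [NormedAddCommGroup E] [NormedSpace ℂ E]
    (M : Type*) [TopologicalSpace M] [ChartedSpace E M] [IsManifold 𝓘(ℂ, E) ω M]
    extends FrobeniusManifold E M where
  /-- the real structure `κ` -/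
  kappa : ∀ x : M, HTan E x →ₛₗ[starRingEnd ℂ] HTan E x
  /-- the Chern connection `D = D' + ∂̄` -/
  D : CovariantDerivative 𝓘(ℝ, E) E (HTan E : M → Type _)
  /-- the super-symmetric index -/
  Q : ∀ x : M, HTan E x →ₗ[ℂ] HTan E x
  kappa_smooth : ∀ (x : M) (σ : ∀ x : M, HTan E x), IsSmoothAt σ x →
    IsSmoothAt (fun y => kappa y (σ y)) x
  kappa_kappa : ∀ (x : M) (v : HTan E x), kappa x (kappa x v) = v
  /-- `g` is real on the real subbundle defined by `κ`, i.e. `h` is Hermitian -/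
  metric_kappa : ∀ (x : M) (v w : HTan E x),
    metric x (kappa x v) (kappa x w) = conj (metric x v w)
  D_smooth : ∀ (x : M) (X σ : ∀ x : M, HTan E x), IsSmoothAt X x → IsSmoothAt σ x →
    IsSmoothAt (fun y => D σ y (X y)) x
  /-- `D` is a connection on a complex vector bundle -/
  D_I : ∀ (x : M) (σ : ∀ x : M, HTan E x), IsSmoothAt σ x → ∀ v : HTan E x,
    D (fun y => Complex.I • σ y) x v = Complex.I • D σ x v
  /-- `D'' = ∂̄` -/
  D_dbar : ∀ (x : M) (σ : ∀ x : M, HTan E x), IsHolAt σ x → ∀ v : HTan E x,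
    dSecond D σ x v = 0
  /-- `D h = 0` -/
  D_hermitian : ∀ (x : M) (σ τ : ∀ x : M, HTan E x), IsSmoothAt σ x → IsSmoothAt τ x →
    ∀ v : HTan E x, mvfderiv 𝓘(ℝ, E) (fun y => metric y (σ y) (kappa y (τ y))) x v =
      metric x (D σ x v) (kappa x (τ x)) + metric x (σ x) (kappa x (D τ x v))
  /-- `D κ = 0` -/
  D_kappa : ∀ (x : M) (σ : ∀ x : M, HTan E x), IsSmoothAt σ x → ∀ v : HTan E x,
    D (fun y => kappa y (σ y)) x v = kappa x (D σ x v)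
  /-- `D'(Φ) = 0` -/
  D_higgs : ∀ (x : M) (X Y σ : ∀ x : M, HTan E x),
    IsHolAt X x → IsHolAt Y x → IsSmoothAt σ x →
    (dPrime D (fun y => toFrobeniusManifold.higgs y (Y y) (σ y)) x (X x)
        - toFrobeniusManifold.higgs x (Y x) (dPrime D σ x (X x)))
      - (dPrime D (fun y => toFrobeniusManifold.higgs y (X y) (σ y)) x (Y x)
        - toFrobeniusManifold.higgs x (X x) (dPrime D σ x (Y x)))
      = toFrobeniusManifold.higgs x (VectorField.mlieBracket 𝓘(ℂ, E) X Y x) (σ x)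
  /-- the harmonicity equation `D'∂̄ + ∂̄D' = -(Φ ∧ Φ† + Φ† ∧ Φ)`, with `Φ†_{Ȳ} = κ Φ_Y κ`,
  evaluated on `(X, Ȳ)` for holomorphic `X` and `Y` (so that `[X, Ȳ] = 0`) -/
  tt_star : ∀ (x : M) (X Y σ : ∀ x : M, HTan E x),
    IsHolAt X x → IsHolAt Y x → IsSmoothAt σ x →
    dPrime D (fun y => dSecond D σ y (Y y)) x (X x)
        - dSecond D (fun y => dPrime D σ y (X y)) x (Y x) =
      -(toFrobeniusManifold.higgs x (X x)
            (conjEnd (kappa x) (toFrobeniusManifold.higgs x (Y x)) (σ x))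
          - conjEnd (kappa x) (toFrobeniusManifold.higgs x (Y x))
            (toFrobeniusManifold.higgs x (X x) (σ x)))
  /-- `𝓠 = D_𝓔 - 𝓛_𝓔 - (2 - d)/2 · Id`; both sides are `𝓞`-linear, so that it is enough to
  evaluate them on holomorphic vector fields -/
  Q_eq : ∀ (x : M) (X : ∀ x : M, HTan E x), IsHolAt X x →
    Q x (X x) = dPrime D X x (euler x) - VectorField.mlieBracket 𝓘(ℂ, E) euler X x
      - ((2 - d) / 2) • X x
  /-- `D'(𝓤) - [Φ, 𝓠] + Φ = 0` -/
  D_U : ∀ (x : M) (σ : ∀ x : M, HTan E x), IsSmoothAt σ x → ∀ v : HTan E x,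
    (dPrime D (fun y => toFrobeniusManifold.U y (σ y)) x v
        - toFrobeniusManifold.U x (dPrime D σ x v))
      - (toFrobeniusManifold.higgs x v (Q x (σ x)) - Q x (toFrobeniusManifold.higgs x v (σ x)))
      + toFrobeniusManifold.higgs x v (σ x) = 0
  /-- `D'(𝓠) + [Φ, κ𝓤κ] = 0` -/
  D_Q : ∀ (x : M) (σ : ∀ x : M, HTan E x), IsSmoothAt σ x → ∀ v : HTan E x,
    (dPrime D (fun y => Q y (σ y)) x v - Q x (dPrime D σ x v))
      + (toFrobeniusManifold.higgs x v (conjEnd (kappa x) (toFrobeniusManifold.U x) (σ x))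
        - conjEnd (kappa x) (toFrobeniusManifold.U x) (toFrobeniusManifold.higgs x v (σ x))) = 0
  /-- `𝓠 + κ𝓠κ = 0` -/
  Q_kappa : ∀ (x : M) (v : HTan E x), Q x v + conjEnd (kappa x) (Q x) v = 0
  /-- `𝓠` is skew with respect to `g` (hence self-adjoint with respect to `h`) -/
  Q_skew : ∀ (x : M) (v w : HTan E x), metric x (Q x v) w = -metric x v (Q x w)

namespace CDVStructure

variable {E : Type*} [NormedAddCommGroup E] [NormedSpace ℂ E]
  {M : Type*} [TopologicalSpace M] [ChartedSpace E M] [IsManifold 𝓘(ℂ, E) ω M]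
  (S : CDVStructure E M)

/-- The Hermitian form `h(v, w) = g(v, κ w)`. -/
def herm (x : M) (v w : HTan E x) : ℂ := S.metric x v (S.kappa x w)

/-- A CDV-structure is a CDV⊕-structure if `h` is positive definite. -/
def IsPositive : Prop := ∀ (x : M) (v : HTan E x), v ≠ 0 → 0 < (S.herm x v v).re

/-- `Φ†_{v̄}`, the `h`-adjoint of `Φ_v`. -/
def higgsDagger (x : M) (v : HTan E x) : HTan E x →ₗ[ℂ] HTan E x :=
  conjEnd (S.kappa x) (S.higgs x v)

/-- `𝓤†`, the `h`-adjoint of `𝓤`. -/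
def UDagger (x : M) : HTan E x →ₗ[ℂ] HTan E x := conjEnd (S.kappa x) (S.U x)

theorem herm_conj (x : M) (v w : HTan E x) : S.herm x w v = conj (S.herm x v w) := by
  unfold herm
  rw [← S.metric_kappa, S.kappa_kappa, S.metric_symm]

theorem herm_higgs (x : M) (v w t : HTan E x) :
    S.herm x (S.higgs x v w) t = S.herm x w (S.higgsDagger x v t) := by
  simp only [herm, higgsDagger, conjEnd, FrobeniusManifold.higgs, LinearMap.comp_apply,
    S.kappa_kappa, LinearMap.neg_apply, map_neg]
  rw [S.mul_comm, S.metric_mul]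

theorem herm_U (x : M) (v w : HTan E x) :
    S.herm x (S.U x v) w = S.herm x v (S.UDagger x w) := by
  simp only [herm, UDagger, conjEnd, FrobeniusManifold.U, LinearMap.comp_apply, S.kappa_kappa]
  rw [S.mul_comm, S.metric_mul]

theorem herm_Q (x : M) (v w : HTan E x) : S.herm x (S.Q x v) w = S.herm x v (S.Q x w) := by
  have h := S.Q_kappa x (S.kappa x w)
  simp only [conjEnd, LinearMap.comp_apply, S.kappa_kappa] at h
  rw [herm, herm, S.Q_skew, eq_neg_of_add_eq_zero_left h, map_neg, neg_neg]

/-- Tate type: `𝓠 = 0`. -/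
def IsTate : Prop := ∀ x : M, S.Q x = 0

/-- `D' = ∇`. -/
def DPrimeEqNabla : Prop :=
  ∀ (x : M) (σ : ∀ x : M, HTan E x), IsHolAt σ x → ∀ v : HTan E x,
    dPrime S.D σ x v = S.nabla σ x v

/-- The holomorphic structure `∂̄ + z Φ†` of `𝓗₂` in the direction `v̄`, for `v` tangent to `M`.
In the direction `∂_{z̄}` this structure is the usual one, given by `partialZBarSec`. -/
def dbarTilde (s : ℂ → ∀ x : M, HTan E x) (z : ℂ) (x : M) (v : HTan E x) : HTan E x :=
  dSecond S.D (s z) x v + z • S.higgsDagger x v (s z x)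

/-- The `(1,0)`-part of the structure connection `D~` of the CV-structure in the direction `∂_z`,
at a point with `z ≠ 0`. -/
def DTildeZ (s : ℂ → ∀ x : M, HTan E x) (z : ℂ) (x : M) : HTan E x :=
  partialZSec s z x
    + z⁻¹ • (z⁻¹ • S.U x (s z x) - S.Q x (s z x) - z • S.UDagger x (s z x))

/-- The `(1,0)`-part of the structure connection `D~` of the CV-structure in the direction `v`,
tangent to `M`, at a point with `z ≠ 0`. -/
def DTilde (s : ℂ → ∀ x : M, HTan E x) (z : ℂ) (x : M) (v : HTan E x) : HTan E x :=
  dPrime S.D (s z) x v + z⁻¹ • S.higgs x v (s z x)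

/-- `φ` is an isomorphism of holomorphic bundles with meromorphic connection
`(𝓗₁, ∇~) ≃ (𝓗₂, D~)` on `ℂ × M`: it is fibrewise bijective, maps each local holomorphic section
`s` of `𝓗₁` to a smooth section annihilated by the holomorphic structure of `𝓗₂`, and
`φ ∇~ s = D~ φ s` away from the polar divisor `z = 0`. -/
structure IsPotential (φ : ℂ → ∀ x : M, HTan E x ≃ₗ[ℂ] HTan E x) : Prop where
  smooth : ∀ (s : ℂ → ∀ x : M, HTan E x) (z : ℂ) (x : M), IsHolAtProd s z x →
    IsSmoothAtProd (fun w y => φ w y (s w y)) z x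
  dbar_z : ∀ (s : ℂ → ∀ x : M, HTan E x) (z : ℂ) (x : M), IsHolAtProd s z x →
    partialZBarSec (fun w y => φ w y (s w y)) z x = 0
  dbar : ∀ (s : ℂ → ∀ x : M, HTan E x) (z : ℂ) (x : M), IsHolAtProd s z x →
    ∀ v : HTan E x, S.dbarTilde (fun w y => φ w y (s w y)) z x v = 0
  connection_z : ∀ (s : ℂ → ∀ x : M, HTan E x) (z : ℂ) (x : M), IsHolAtProd s z x → z ≠ 0 →
    φ z x (S.nablaTildeZ s z x) = S.DTildeZ (fun w y => φ w y (s w y)) z x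
  connection : ∀ (s : ℂ → ∀ x : M, HTan E x) (z : ℂ) (x : M), IsHolAtProd s z x → z ≠ 0 →
    ∀ v : HTan E x,
      φ z x (S.nablaTilde s z x v) = S.DTilde (fun w y => φ w y (s w y)) z x v

/-- Strong potentiality: `(𝓗₁, ∇~)` and `(𝓗₂, D~)` are isomorphic. -/
def IsStronglyPotential : Prop :=
  ∃ φ : ℂ → ∀ x : M, HTan E x ≃ₗ[ℂ] HTan E x, S.IsPotential φ

end CDVStructure

end

end TTStar

/-! Semisimplicity splits each tangent algebra into copies of `ℂ`, so near every point there is a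
holomorphic frame of orthogonal idempotents `e_i` (`exists_idempotentFrame`). In it all `Φ_v` are
diagonal, and `𝓤` is diagonal with distinct eigenvalues `u_i` (`eig`). Everything is computed in
such frames.

Let `D' = ∇`. Both terms on the left of the harmonicity equation vanish on holomorphic frames,
because `∇` preserves holomorphy; hence `Φ` commutes with `Φ†`. Multiplication by `e_i` is then a
normal operator, so the `e_i` are `h`-orthogonal (`herm_frame_of_ne`) and `κ` preserves each line `ℂ
e_i`. Differentiating `h(e_i, e_j) = 0` puts `D e_i` on the line of `e_i`, and flatness of `∑ e_i =
e` gives `D e_i = 0` (`D_frame`). The equation for `D'(𝓤)` now says that the `du_i` form the dual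
coframe and that `𝓠` is diagonal; a diagonal `g`-skew `𝓠` is zero (`Q_eq_zero_of_frame`). With `𝓥 =
𝓠 = 0` and `𝓤† = diag(ū_i)`, the map `exp(z 𝓤†)` intertwines the two structures
(`isPotential_of_frames`).

Conversely, if `𝓠 = 0`, the equation for `D'(𝓤)` makes `D e_i` a multiple of `e_i` because the `u_i`
are distinct; `g(e_i, e_i)` is constant when `∇ e_i = 0`, and `D g = 0`, so the multiple is zero
(`D_frame_of_tate`).

For uniqueness, the matrix entries of a potential multiplied by `exp(-z ū_j)` are entire in `z` and
satisfy `z² f' = (u_i - u_j) f`. Off the diagonal this singularity is irregular and forces `f = 0`;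
on the diagonal `f` is constant in `z`, and the equations along `M` make it locally constant there
(`exists_potential_constants`). -/

open scoped Topology

namespace TTStar

noncomputable section

/-! ### Holomorphic and smooth sections in local coordinates. -/

section Regularity

variable {E : Type*} [NormedAddCommGroup E] [NormedSpace ℂ E]
  {M : Type*} [TopologicalSpace M] [ChartedSpace E M]
  {G : Type*} [NormedAddCommGroup G] [NormedSpace ℂ G]

/-- The real and complex models have the same charts, so only the scalars of the chart expression
are restricted. -/
theorem contMDiffAt_real_of_complex {f : M → G} {x : M}
    (h : ContMDiffAt 𝓘(ℂ, E) 𝓘(ℂ, G) ω f x) : ContMDiffAt 𝓘(ℝ, E) 𝓘(ℝ, G) ∞ f x := by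
  rw [contMDiffAt_iff] at h ⊢
  exact ⟨h.1, (h.2.of_le le_top).restrict_scalars ℝ⟩

theorem contMDiffAt_prod_real_of_complex {f : ℂ × M → G} {p : ℂ × M}
    (h : ContMDiffAt (𝓘(ℂ, ℂ).prod 𝓘(ℂ, E)) 𝓘(ℂ, G) ω f p) :
    ContMDiffAt (𝓘(ℝ, ℂ).prod 𝓘(ℝ, E)) 𝓘(ℝ, G) ∞ f p := by
  rw [contMDiffAt_iff] at h ⊢
  exact ⟨h.1, (h.2.of_le le_top).restrict_scalars ℝ⟩

theorem mvfderiv_real_of_complex {f : M → G} {x : M}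
    (h : MDifferentiableAt 𝓘(ℂ, E) 𝓘(ℂ, G) f x) (v : HTan E x) :
    mvfderiv 𝓘(ℝ, E) f x v = mvfderiv 𝓘(ℂ, E) f x v := by
  have h1 : HasMFDerivAt 𝓘(ℂ, E) 𝓘(ℂ, G) f x (mfderiv 𝓘(ℂ, E) 𝓘(ℂ, G) f x) := h.hasMFDerivAt
  have h2 : HasMFDerivAt 𝓘(ℝ, E) 𝓘(ℝ, G) f x
      ((mfderiv 𝓘(ℂ, E) 𝓘(ℂ, G) f x : E →L[ℂ] G).restrictScalars ℝ) :=
    ⟨h1.1, h1.2.restrictScalars ℝ⟩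
  simp only [mvfderiv]
  rw [h2.mfderiv]
  rfl

theorem mvfderiv_congr {𝕜 : Type*} [NontriviallyNormedField 𝕜] [NormedSpace 𝕜 E]
    {V : Type*} [NormedAddCommGroup V] [NormedSpace 𝕜 V] {f g : M → V} {x : M}
    (h : f =ᶠ[𝓝 x] g) (v : HTan E x) : mvfderiv 𝓘(𝕜, E) f x v = mvfderiv 𝓘(𝕜, E) g x v := by
  have := h.mfderiv_eq (I := 𝓘(𝕜, E)) (I' := 𝓘(𝕜, V))
  change (mfderiv 𝓘(𝕜, E) 𝓘(𝕜, V) f x : E →L[𝕜] V) v = _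
  rw [this]
  rfl

variable [IsManifold 𝓘(ℂ, E) ω M]

/-- The linear coordinates on `HTan E y`, for `y` near `x`, given by the trivialization of the
tangent bundle at `x`. -/
def coord (x y : M) : HTan E y →L[ℂ] E :=
  (trivializationAt E (HTan E : M → Type _) x).continuousLinearMapAt ℂ y

/-- The vector at `y` with given coordinates in the trivialization at `x`. -/
def ofCoord (x y : M) : E →L[ℂ] HTan E y :=
  (trivializationAt E (HTan E : M → Type _) x).symmL ℂ y

/-- The domain of the trivialization at `x`. -/
def coordDomain (E : Type*) [NormedAddCommGroup E] [NormedSpace ℂ E]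
    {M : Type*} [TopologicalSpace M] [ChartedSpace E M] [IsManifold 𝓘(ℂ, E) ω M]
    (x : M) : Set M :=
  (trivializationAt E (HTan E : M → Type _) x).baseSet

theorem coordDomain_mem_nhds (x : M) : coordDomain E x ∈ 𝓝 x :=
  (trivializationAt E (HTan E : M → Type _) x).open_baseSet.mem_nhds
    (FiberBundle.mem_baseSet_trivializationAt' x)

theorem ofCoord_coord {x y : M} (hy : y ∈ coordDomain E x) (v : HTan E y) :
    ofCoord x y (coord x y v) = v :=
  (trivializationAt E (HTan E : M → Type _) x).symmL_continuousLinearMapAt hy v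

theorem coord_ofCoord {x y : M} (hy : y ∈ coordDomain E x) (v : E) :
    coord x y (ofCoord x y v) = v :=
  (trivializationAt E (HTan E : M → Type _) x).continuousLinearMapAt_symmL hy v

theorem coord_eq {x y : M} (hy : y ∈ coordDomain E x) (v : HTan E y) :
    coord x y v = (trivializationAt E (HTan E : M → Type _) x ⟨y, v⟩).2 := by
  simp only [coord, Trivialization.continuousLinearMapAt_apply]
  rw [Trivialization.coe_linearMapAt_of_mem _ hy]

theorem isHolAt_iff {X : ∀ x : M, HTan E x} {x : M} :
    IsHolAt X x ↔ ContMDiffAt 𝓘(ℂ, E) 𝓘(ℂ, E) ω (fun y => coord x y (X y)) x := by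
  rw [IsHolAt, Bundle.contMDiffAt_section]
  refine Filter.EventuallyEq.contMDiffAt_iff ?_
  filter_upwards [coordDomain_mem_nhds (E := E) x] with y hy
  rw [coord_eq hy]

theorem isSmoothAt_iff {X : ∀ x : M, HTan E x} {x : M} :
    IsSmoothAt X x ↔ ContMDiffAt 𝓘(ℝ, E) 𝓘(ℝ, E) ∞ (fun y => coord x y (X y)) x := by
  rw [IsSmoothAt, Bundle.contMDiffAt_section]
  refine Filter.EventuallyEq.contMDiffAt_iff ?_
  filter_upwards [coordDomain_mem_nhds (E := E) x] with y hy
  rw [coord_eq hy]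

theorem snd_mem_coordDomain (z : ℂ) (x : M) :
    ∀ᶠ p : ℂ × M in 𝓝 (z, x), p.2 ∈ coordDomain E x :=
  continuousAt_snd.eventually (coordDomain_mem_nhds (E := E) x)

theorem isHolAtProd_iff {s : ℂ → ∀ x : M, HTan E x} {z : ℂ} {x : M} :
    IsHolAtProd s z x ↔ ContMDiffAt (𝓘(ℂ, ℂ).prod 𝓘(ℂ, E)) 𝓘(ℂ, E) ω
      (fun p : ℂ × M => coord x p.2 (s p.1 p.2)) (z, x) := by
  rw [IsHolAtProd, Bundle.contMDiffAt_totalSpace]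
  rw [and_iff_right contMDiffAt_snd]
  refine Filter.EventuallyEq.contMDiffAt_iff ?_
  filter_upwards [snd_mem_coordDomain (E := E) z x] with y hy
  rw [coord_eq hy]

theorem isSmoothAtProd_iff {s : ℂ → ∀ x : M, HTan E x} {z : ℂ} {x : M} :
    IsSmoothAtProd s z x ↔ ContMDiffAt (𝓘(ℝ, ℂ).prod 𝓘(ℝ, E)) 𝓘(ℝ, E) ∞
      (fun p : ℂ × M => coord x p.2 (s p.1 p.2)) (z, x) := by
  rw [IsSmoothAtProd, Bundle.contMDiffAt_totalSpace]
  rw [and_iff_right contMDiffAt_snd]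
  refine Filter.EventuallyEq.contMDiffAt_iff ?_
  filter_upwards [snd_mem_coordDomain (E := E) z x] with y hy
  rw [coord_eq hy]

theorem IsHolAt.isSmoothAt {X : ∀ x : M, HTan E x} {x : M} (h : IsHolAt X x) :
    IsSmoothAt X x :=
  isSmoothAt_iff.2 (contMDiffAt_real_of_complex (isHolAt_iff.1 h))

theorem IsHolAtProd.isSmoothAtProd {s : ℂ → ∀ x : M, HTan E x} {z : ℂ} {x : M}
    (h : IsHolAtProd s z x) : IsSmoothAtProd s z x :=
  isSmoothAtProd_iff.2 (contMDiffAt_prod_real_of_complex (isHolAtProd_iff.1 h))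

theorem IsHolAtProd.slice {s : ℂ → ∀ x : M, HTan E x} {z : ℂ} {x : M}
    (h : IsHolAtProd s z x) : IsHolAt (s z) x := by
  rw [isHolAtProd_iff] at h
  rw [isHolAt_iff]
  exact ContMDiffAt.comp (f := fun y : M => (z, y)) x h
    (contMDiffAt_const.prodMk contMDiffAt_id)

theorem IsHolAt.isHolAtProd {X : ∀ x : M, HTan E x} {x : M} (h : IsHolAt X x) (z : ℂ) :
    IsHolAtProd (fun _ => X) z x := by
  rw [isHolAtProd_iff]
  rw [isHolAt_iff] at h
  exact ContMDiffAt.comp (f := fun p : ℂ × M => p.2) (z, x) h contMDiffAt_snd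

theorem IsHolAt.congr {X Y : ∀ x : M, HTan E x} {x : M} (h : IsHolAt X x)
    (hXY : ∀ᶠ y in 𝓝 x, X y = Y y) : IsHolAt Y x := by
  rw [isHolAt_iff] at h ⊢
  exact h.congr_of_eventuallyEq (hXY.mono fun y hy => by simp only [hy])

theorem IsSmoothAt.congr {X Y : ∀ x : M, HTan E x} {x : M} (h : IsSmoothAt X x)
    (hXY : ∀ᶠ y in 𝓝 x, X y = Y y) : IsSmoothAt Y x := by
  rw [isSmoothAt_iff] at h ⊢
  exact h.congr_of_eventuallyEq (hXY.mono fun y hy => by simp only [hy])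

theorem isHolAt_zero (x : M) : IsHolAt (fun _ => 0 : ∀ x : M, HTan E x) x := by
  rw [isHolAt_iff]
  simp only [map_zero]
  exact contMDiffAt_const

/-- Constant coordinates extend any vector to a holomorphic germ. Identities stated for holomorphic
fields can thus be evaluated on single vectors. -/
theorem isHolAt_ofCoord (x : M) (v : E) : IsHolAt (fun y => ofCoord x y v) x := by
  rw [isHolAt_iff]
  refine (contMDiffAt_const (c := v)).congr_of_eventuallyEq ?_
  filter_upwards [coordDomain_mem_nhds (E := E) x] with y hy
  exact coord_ofCoord hy v

theorem IsHolAt.sum {ι : Type*} (t : Finset ι) {X : ι → ∀ x : M, HTan E x} {x : M}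
    (h : ∀ i ∈ t, IsHolAt (X i) x) : IsHolAt (fun y => ∑ i ∈ t, X i y) x := by
  rw [isHolAt_iff]
  simp only [map_sum]
  exact contMDiffAt_finsetSum fun i hi => isHolAt_iff.1 (h i hi)

theorem IsSmoothAt.sum {ι : Type*} (t : Finset ι) {X : ι → ∀ x : M, HTan E x} {x : M}
    (h : ∀ i ∈ t, IsSmoothAt (X i) x) : IsSmoothAt (fun y => ∑ i ∈ t, X i y) x := by
  rw [isSmoothAt_iff]
  simp only [map_sum]
  exact contMDiffAt_finsetSum fun i hi => isSmoothAt_iff.1 (h i hi)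

theorem ContMDiffAt.complex_smul {N H B : Type*} [NormedAddCommGroup B] [NormedSpace ℝ B]
    [TopologicalSpace H] [TopologicalSpace N] [ChartedSpace H N] {I : ModelWithCorners ℝ B H}
    {f : N → ℂ} {g : N → E} {x : N} (hf : ContMDiffAt I 𝓘(ℝ, ℂ) ∞ f x)
    (hg : ContMDiffAt I 𝓘(ℝ, E) ∞ g x) : ContMDiffAt I 𝓘(ℝ, E) ∞ (fun y => f y • g y) x := by
  have h : ContDiff ℝ ∞ (fun p : ℂ × E => p.1 • p.2) := contDiff_fst.smul contDiff_snd
  exact h.contDiffAt.contMDiffAt.comp x (hf.prodMk_space hg)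

theorem IsSmoothAt.smul {f : M → ℂ} {X : ∀ x : M, HTan E x} {x : M}
    (hf : ContMDiffAt 𝓘(ℝ, E) 𝓘(ℝ, ℂ) ∞ f x) (h : IsSmoothAt X x) :
    IsSmoothAt (fun y => f y • X y) x := by
  rw [isSmoothAt_iff] at h ⊢
  simp only [map_smul]
  exact ContMDiffAt.complex_smul hf h

theorem IsHolAt.smul {f : M → ℂ} {X : ∀ x : M, HTan E x} {x : M}
    (hf : ContMDiffAt 𝓘(ℂ, E) 𝓘(ℂ, ℂ) ω f x) (h : IsHolAt X x) :
    IsHolAt (fun y => f y • X y) x := by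
  rw [isHolAt_iff] at h ⊢
  simp only [map_smul]
  exact hf.smul h

theorem IsSmoothAtProd.smul {f : ℂ × M → ℂ} {s : ℂ → ∀ x : M, HTan E x} {z : ℂ} {x : M}
    (hf : ContMDiffAt (𝓘(ℝ, ℂ).prod 𝓘(ℝ, E)) 𝓘(ℝ, ℂ) ∞ f (z, x)) (h : IsSmoothAtProd s z x) :
    IsSmoothAtProd (fun w y => f (w, y) • s w y) z x := by
  rw [isSmoothAtProd_iff] at h ⊢
  simp only [map_smul]
  exact ContMDiffAt.complex_smul hf h

theorem IsSmoothAtProd.sum {ι : Type*} (t : Finset ι) {s : ι → ℂ → ∀ x : M, HTan E x}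
    {z : ℂ} {x : M} (h : ∀ i ∈ t, IsSmoothAtProd (s i) z x) :
    IsSmoothAtProd (fun w y => ∑ i ∈ t, s i w y) z x := by
  rw [isSmoothAtProd_iff]
  simp only [map_sum]
  exact contMDiffAt_finsetSum fun i hi => isSmoothAtProd_iff.1 (h i hi)

theorem IsSmoothAtProd.congr {s t : ℂ → ∀ x : M, HTan E x} {z : ℂ} {x : M}
    (h : IsSmoothAtProd s z x) (hst : ∀ᶠ p : ℂ × M in 𝓝 (z, x), s p.1 p.2 = t p.1 p.2) :
    IsSmoothAtProd t z x := by
  rw [isSmoothAtProd_iff] at h ⊢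
  exact h.congr_of_eventuallyEq (hst.mono fun y hy => by simp only [hy])

/-- Regularity of `g` is given only on holomorphic fields; a smooth `s` is therefore expanded, with
smooth coefficients, in a local holomorphic frame. -/
theorem FrobeniusManifold.metric_smooth_prod [FiniteDimensional ℂ E] (F : FrobeniusManifold E M)
    {s : ℂ → ∀ x : M, HTan E x} {X : ∀ x : M, HTan E x} {z : ℂ} {x : M}
    (hs : IsSmoothAtProd s z x) (hX : IsHolAt X x) :
    ContMDiffAt (𝓘(ℝ, ℂ).prod 𝓘(ℝ, E)) 𝓘(ℝ, ℂ) ∞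
      (fun p : ℂ × M => F.metric p.2 (s p.1 p.2) (X p.2)) (z, x) := by
  let b := Module.finBasis ℂ E
  have key : (fun p : ℂ × M => F.metric p.2 (s p.1 p.2) (X p.2)) =ᶠ[𝓝 (z, x)] fun p =>
      ∑ k, b.repr (coord x p.2 (s p.1 p.2)) k • F.metric p.2 (ofCoord x p.2 (b k)) (X p.2) := by
    filter_upwards [snd_mem_coordDomain (E := E) z x] with p hp
    conv_lhs => rw [← ofCoord_coord hp (s p.1 p.2), ← b.sum_repr (coord x p.2 (s p.1 p.2))]
    simp only [map_sum, map_smul, LinearMap.sum_apply, LinearMap.smul_apply]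
  refine ContMDiffAt.congr_of_eventuallyEq ?_ key
  refine contMDiffAt_finsetSum fun k _ => ContMDiffAt.complex_smul ?_ ?_
  · have hk : ContDiff ℝ ∞ (fun v : E => b.repr v k) := by
      have := (LinearMap.toContinuousLinearMap (b.coord k)).restrictScalars ℝ |>.contDiff (n := ∞)
      exact this
    exact hk.contDiffAt.contMDiffAt.comp (z, x) (isSmoothAtProd_iff.1 hs)
  · have h := contMDiffAt_real_of_complex
      (F.metric_holomorphic x _ X (isHolAt_ofCoord x (b k)) hX)
    exact ContMDiffAt.comp (f := fun p : ℂ × M => p.2) (z, x) h contMDiffAt_snd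

end Regularity

/-! ### Wirtinger derivatives of functions on `M`. -/

section Functions

variable {E : Type*} [NormedAddCommGroup E] [NormedSpace ℂ E]
  {M : Type*} [TopologicalSpace M] [ChartedSpace E M]

theorem mvfderiv_clm_comp {V W : Type*} [NormedAddCommGroup V] [NormedSpace ℝ V]
    [NormedAddCommGroup W] [NormedSpace ℝ W] (L : V →L[ℝ] W) {f : M → V} {x : M}
    (hf : MDifferentiableAt 𝓘(ℝ, E) 𝓘(ℝ, V) f x) (v : HTan E x) :
    mvfderiv 𝓘(ℝ, E) (fun y => L (f y)) x v = L (mvfderiv 𝓘(ℝ, E) f x v) := by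
  have h := (L.hasFDerivAt (x := f x)).hasMFDerivAt.comp x hf.hasMFDerivAt
  change (mfderiv 𝓘(ℝ, E) 𝓘(ℝ, W) (L ∘ f) x : E →L[ℝ] W) v = _
  rw [h.mfderiv]
  rfl

/-- `∂f/∂v` for a `C^∞` function `f`. -/
def delFun (f : M → ℂ) (x : M) (v : HTan E x) : ℂ :=
  (1 / 2 : ℂ) * (mvfderiv 𝓘(ℝ, E) f x v
    - Complex.I * mvfderiv 𝓘(ℝ, E) f x (Complex.I • v : HTan E x))

/-- `∂f/∂v̄` for a `C^∞` function `f`. -/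
def delBarFun (f : M → ℂ) (x : M) (v : HTan E x) : ℂ :=
  (1 / 2 : ℂ) * (mvfderiv 𝓘(ℝ, E) f x v
    + Complex.I * mvfderiv 𝓘(ℝ, E) f x (Complex.I • v : HTan E x))

theorem delFun_of_hol {f : M → ℂ} {x : M} (hf : ContMDiffAt 𝓘(ℂ, E) 𝓘(ℂ, ℂ) ω f x)
    (v : HTan E x) : delFun f x v = mvfderiv 𝓘(ℂ, E) f x v := by
  have h := hf.mdifferentiableAt (by simp)
  simp only [delFun, mvfderiv_real_of_complex h]
  rw [(mvfderiv 𝓘(ℂ, E) f x).map_smul, smul_eq_mul, ← mul_assoc, Complex.I_mul_I]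
  ring

theorem delBarFun_of_hol {f : M → ℂ} {x : M} (hf : ContMDiffAt 𝓘(ℂ, E) 𝓘(ℂ, ℂ) ω f x)
    (v : HTan E x) : delBarFun f x v = 0 := by
  have h := hf.mdifferentiableAt (by simp)
  simp only [delBarFun, mvfderiv_real_of_complex h]
  rw [(mvfderiv 𝓘(ℂ, E) f x).map_smul, smul_eq_mul, ← mul_assoc, Complex.I_mul_I]
  ring

theorem mvfderiv_mul_real {f g : M → ℂ} {x : M}
    (hf : ContMDiffAt 𝓘(ℝ, E) 𝓘(ℝ, ℂ) ∞ f x) (hg : ContMDiffAt 𝓘(ℝ, E) 𝓘(ℝ, ℂ) ∞ g x)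
    (v : HTan E x) : mvfderiv 𝓘(ℝ, E) (fun y => f y * g y) x v =
      f x * mvfderiv 𝓘(ℝ, E) g x v + mvfderiv 𝓘(ℝ, E) f x v * g x := by
  have h1 := (hf.mdifferentiableAt (by simp)).hasMFDerivAt
  have h2 := (hg.mdifferentiableAt (by simp)).hasMFDerivAt
  have h3 := h1.mul' h2
  change (mfderiv 𝓘(ℝ, E) 𝓘(ℝ, ℂ) (f * g) x : E →L[ℝ] ℂ) v = _
  rw [h3.mfderiv]
  rfl

theorem delFun_mul {f g : M → ℂ} {x : M}
    (hf : ContMDiffAt 𝓘(ℝ, E) 𝓘(ℝ, ℂ) ∞ f x) (hg : ContMDiffAt 𝓘(ℝ, E) 𝓘(ℝ, ℂ) ∞ g x)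
    (v : HTan E x) :
    delFun (fun y => f y * g y) x v = f x * delFun g x v + delFun f x v * g x := by
  simp only [delFun, mvfderiv_mul_real hf hg]
  ring

theorem delBarFun_mul {f g : M → ℂ} {x : M}
    (hf : ContMDiffAt 𝓘(ℝ, E) 𝓘(ℝ, ℂ) ∞ f x) (hg : ContMDiffAt 𝓘(ℝ, E) 𝓘(ℝ, ℂ) ∞ g x)
    (v : HTan E x) :
    delBarFun (fun y => f y * g y) x v = f x * delBarFun g x v + delBarFun f x v * g x := by
  simp only [delBarFun, mvfderiv_mul_real hf hg]
  ring

/-- The twisting factor `exp (c ū)` for a holomorphic function `u`. -/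
theorem contMDiffAt_exp_conj {u : M → ℂ} {x : M} (hu : ContMDiffAt 𝓘(ℂ, E) 𝓘(ℂ, ℂ) ω u x)
    (c : ℂ) : ContMDiffAt 𝓘(ℝ, E) 𝓘(ℝ, ℂ) ∞ (fun y => Complex.exp (c * conj (u y))) x := by
  have h : ContDiff ℝ ∞ (fun a : ℂ => Complex.exp (c * conj a)) :=
    (contDiff_const.mul Complex.conjCLE.contDiff).cexp
  exact h.contDiffAt.contMDiffAt.comp x (contMDiffAt_real_of_complex hu)

theorem mvfderiv_exp_conj {u : M → ℂ} {x : M} (hu : ContMDiffAt 𝓘(ℂ, E) 𝓘(ℂ, ℂ) ω u x)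
    (c : ℂ) (v : HTan E x) :
    mvfderiv 𝓘(ℝ, E) (fun y => Complex.exp (c * conj (u y))) x v =
      Complex.exp (c * conj (u x)) * (c * conj (mvfderiv 𝓘(ℂ, E) u x v)) := by
  have hd := hu.mdifferentiableAt (by simp)
  have hr := (contMDiffAt_real_of_complex hu).mdifferentiableAt (by simp)
  have h1 : HasFDerivAt (fun a : ℂ => Complex.exp (c * conj a))
      (Complex.exp (c * conj (u x)) • (c • (Complex.conjCLE : ℂ →L[ℝ] ℂ))) (u x) :=
    ((Complex.conjCLE.hasFDerivAt (x := u x)).const_mul c).cexp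
  have h2 := h1.hasMFDerivAt.comp x hr.hasMFDerivAt
  change (mfderiv 𝓘(ℝ, E) 𝓘(ℝ, ℂ) ((fun a : ℂ => Complex.exp (c * conj a)) ∘ u) x
    : E →L[ℝ] ℂ) v = _
  rw [h2.mfderiv, ← mvfderiv_real_of_complex hd]
  rfl

theorem delFun_exp_conj {u : M → ℂ} {x : M} (hu : ContMDiffAt 𝓘(ℂ, E) 𝓘(ℂ, ℂ) ω u x)
    (c : ℂ) (v : HTan E x) : delFun (fun y => Complex.exp (c * conj (u y))) x v = 0 := by
  simp only [delFun, mvfderiv_exp_conj hu]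
  rw [(mvfderiv 𝓘(ℂ, E) u x).map_smul, smul_eq_mul, map_mul, Complex.conj_I]
  linear_combination (1 / 2 * Complex.exp (c * conj (u x)) * c *
    conj (mvfderiv 𝓘(ℂ, E) u x v)) * Complex.I_mul_I

theorem delBarFun_exp_conj {u : M → ℂ} {x : M} (hu : ContMDiffAt 𝓘(ℂ, E) 𝓘(ℂ, ℂ) ω u x)
    (c : ℂ) (v : HTan E x) : delBarFun (fun y => Complex.exp (c * conj (u y))) x v =
      Complex.exp (c * conj (u x)) * (c * conj (mvfderiv 𝓘(ℂ, E) u x v)) := by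
  simp only [delBarFun, mvfderiv_exp_conj hu]
  rw [(mvfderiv 𝓘(ℂ, E) u x).map_smul, smul_eq_mul, map_mul, Complex.conj_I]
  linear_combination (-1 / 2 * Complex.exp (c * conj (u x)) * c *
    conj (mvfderiv 𝓘(ℂ, E) u x v)) * Complex.I_mul_I

end Functions

/-! ### Leibniz rules and locality for `∇`, `D'` and `D''`. -/

section Connections

variable {E : Type*} [NormedAddCommGroup E] [NormedSpace ℂ E]
  {M : Type*} [TopologicalSpace M] [ChartedSpace E M] [IsManifold 𝓘(ℂ, E) ω M]

namespace FrobeniusManifold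

variable (F : FrobeniusManifold E M)

theorem nabla_smul {f : M → ℂ} {X : ∀ x : M, HTan E x} {x : M}
    (hf : ContMDiffAt 𝓘(ℂ, E) 𝓘(ℂ, ℂ) ω f x) (hX : IsHolAt X x) (v : HTan E x) :
    F.nabla (fun y => f y • X y) x v =
      f x • F.nabla X x v + (mvfderiv 𝓘(ℂ, E) f x v : ℂ) • X x := by
  have := F.nabla.isCovariantDerivativeOnUniv.leibniz (x := x)
    (ContMDiffAt.mdifferentiableAt hX (by simp)) (hf.mdifferentiableAt (by simp))
  exact congrArg (fun A => A v) this

theorem nabla_sum {ι : Type*} (t : Finset ι) {X : ι → ∀ x : M, HTan E x} {x : M}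
    (h : ∀ i ∈ t, IsHolAt (X i) x) (v : HTan E x) :
    F.nabla (fun y => ∑ i ∈ t, X i y) x v = ∑ i ∈ t, F.nabla (X i) x v := by
  classical
  induction t using Finset.induction_on with
  | empty =>
    have : F.nabla (fun y => 0) x = 0 := congrFun F.nabla.zero x
    simp only [Finset.sum_empty, this]
    rfl
  | insert a t ha ih =>
    have h2 := IsHolAt.sum t fun i hi => h i (Finset.mem_insert_of_mem hi)
    have := F.nabla.isCovariantDerivativeOnUniv.add (x := x)
      (ContMDiffAt.mdifferentiableAt (h a (Finset.mem_insert_self a t)) (by simp))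
      (ContMDiffAt.mdifferentiableAt h2 (by simp))
    simp only [Finset.sum_insert ha]
    rw [← ih fun i hi => h i (Finset.mem_insert_of_mem hi)]
    exact congrArg (fun A => A v) this

theorem nabla_congr {X Y : ∀ x : M, HTan E x} {x : M} (hX : IsHolAt X x)
    (hXY : ∀ᶠ y in 𝓝 x, X y = Y y) : F.nabla X x = F.nabla Y x :=
  F.nabla.isCovariantDerivativeOnUniv.congr_of_eventuallyEq
    (ContMDiffAt.mdifferentiableAt hX (by simp))
    (ContMDiffAt.mdifferentiableAt (hX.congr hXY) (by simp)) Filter.univ_mem hXY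

end FrobeniusManifold

namespace CDVStructure

variable (S : CDVStructure E M)

theorem D_congr {σ τ : ∀ x : M, HTan E x} {x : M} (hσ : IsSmoothAt σ x)
    (h : ∀ᶠ y in 𝓝 x, σ y = τ y) : S.D σ x = S.D τ x :=
  S.D.isCovariantDerivativeOnUniv.congr_of_eventuallyEq
    (ContMDiffAt.mdifferentiableAt hσ (by simp))
    (ContMDiffAt.mdifferentiableAt (hσ.congr h) (by simp)) Filter.univ_mem h

theorem D_add {σ τ : ∀ x : M, HTan E x} {x : M} (hσ : IsSmoothAt σ x) (hτ : IsSmoothAt τ x)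
    (v : HTan E x) : S.D (fun y => σ y + τ y) x v = S.D σ x v + S.D τ x v := by
  have := S.D.isCovariantDerivativeOnUniv.add (x := x)
    (ContMDiffAt.mdifferentiableAt hσ (by simp)) (ContMDiffAt.mdifferentiableAt hτ (by simp))
  exact congrArg (fun A => A v) this

theorem D_zero (x : M) (v : HTan E x) : S.D (fun _ => 0) x v = 0 := by
  have h0 : IsSmoothAt (fun _ => 0 : ∀ x : M, HTan E x) x := (isHolAt_zero x).isSmoothAt
  have := S.D_add h0 h0 v
  simpa using this

theorem D_sum {ι : Type*} (t : Finset ι) {X : ι → ∀ x : M, HTan E x} {x : M}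
    (h : ∀ i ∈ t, IsSmoothAt (X i) x) (v : HTan E x) :
    S.D (fun y => ∑ i ∈ t, X i y) x v = ∑ i ∈ t, S.D (X i) x v := by
  classical
  induction t using Finset.induction_on with
  | empty => simp only [Finset.sum_empty, S.D_zero]
  | insert a t ha ih =>
    simp only [Finset.sum_insert ha]
    rw [← ih fun i hi => h i (Finset.mem_insert_of_mem hi)]
    exact S.D_add (h a (Finset.mem_insert_self a t))
      (IsSmoothAt.sum t fun i hi => h i (Finset.mem_insert_of_mem hi)) v

theorem D_real_smul {f : M → ℝ} {σ : ∀ x : M, HTan E x} {x : M}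
    (hf : ContMDiffAt 𝓘(ℝ, E) 𝓘(ℝ, ℝ) ∞ f x) (hσ : IsSmoothAt σ x) (v : HTan E x) :
    S.D (fun y => (f y : ℂ) • σ y) x v =
      (f x : ℂ) • S.D σ x v + ((mvfderiv 𝓘(ℝ, E) f x v : ℝ) : ℂ) • σ x := by
  have := S.D.isCovariantDerivativeOnUniv.leibniz (x := x)
    (ContMDiffAt.mdifferentiableAt hσ (by simp)) (hf.mdifferentiableAt (by simp))
  exact congrArg (fun A => A v) this

/-- As a `CovariantDerivative`, `D` obeys the Leibniz rule for real functions only. Splitting `f`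
into real and imaginary parts and using `D_I` gives the complex rule. -/
theorem D_smul {f : M → ℂ} {σ : ∀ x : M, HTan E x} {x : M}
    (hf : ContMDiffAt 𝓘(ℝ, E) 𝓘(ℝ, ℂ) ∞ f x) (hσ : IsSmoothAt σ x) (v : HTan E x) :
    S.D (fun y => f y • σ y) x v =
      f x • S.D σ x v + (mvfderiv 𝓘(ℝ, E) f x v : ℂ) • σ x := by
  have hre : ContMDiffAt 𝓘(ℝ, E) 𝓘(ℝ, ℝ) ∞ (fun y => (f y).re) x :=
    Complex.reCLM.contDiff.contDiffAt.contMDiffAt.comp x hf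
  have him : ContMDiffAt 𝓘(ℝ, E) 𝓘(ℝ, ℝ) ∞ (fun y => (f y).im) x :=
    Complex.imCLM.contDiff.contDiffAt.contMDiffAt.comp x hf
  have hIσ : IsSmoothAt (fun y => Complex.I • σ y) x :=
    IsSmoothAt.smul contMDiffAt_const hσ
  have hofReal : ∀ {g : M → ℝ}, ContMDiffAt 𝓘(ℝ, E) 𝓘(ℝ, ℝ) ∞ g x →
      ContMDiffAt 𝓘(ℝ, E) 𝓘(ℝ, ℂ) ∞ (fun y => (g y : ℂ)) x := fun hg =>
    Complex.ofRealCLM.contDiff.contDiffAt.contMDiffAt.comp x hg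
  have hsplit : (fun y => f y • σ y) =
      fun y => ((f y).re : ℂ) • σ y + ((f y).im : ℂ) • (Complex.I • σ y) := by
    funext y
    rw [smul_smul, ← add_smul, Complex.re_add_im]
  have hd := hf.mdifferentiableAt (by simp)
  have h1 := mvfderiv_clm_comp Complex.reCLM hd v
  have h2 := mvfderiv_clm_comp Complex.imCLM hd v
  simp only [Complex.reCLM_apply, Complex.imCLM_apply] at h1 h2
  rw [hsplit, S.D_add (IsSmoothAt.smul (hofReal hre) hσ) (IsSmoothAt.smul (hofReal him) hIσ),
    S.D_real_smul hre hσ, S.D_real_smul him hIσ, S.D_I x σ hσ, h1, h2]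
  set a : ℂ := mvfderiv 𝓘(ℝ, E) f x v
  conv_rhs => rw [← Complex.re_add_im (f x), ← Complex.re_add_im a]
  module

theorem D_eq_dPrime {σ : ∀ x : M, HTan E x} {x : M} (hσ : IsHolAt σ x) (v : HTan E x) :
    S.D σ x v = dPrime S.D σ x v := by
  have h := S.D_dbar x σ hσ v
  have h2 : S.D σ x v = dPrime S.D σ x v + dSecond S.D σ x v := by
    simp only [dPrime, dSecond]
    module
  rw [h2, h, add_zero]

theorem D_I_smul {σ : ∀ x : M, HTan E x} {x : M} (hσ : IsHolAt σ x) (v : HTan E x) :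
    S.D σ x (Complex.I • v : HTan E x) = Complex.I • S.D σ x v := by
  have h := S.D_dbar x σ hσ v
  simp only [dSecond, smul_eq_zero] at h
  have h2 := h.resolve_left (by norm_num)
  rw [eq_neg_of_add_eq_zero_left h2, smul_neg, smul_smul, Complex.I_mul_I]
  simp

theorem dPrime_smul {f : M → ℂ} {σ : ∀ x : M, HTan E x} {x : M}
    (hf : ContMDiffAt 𝓘(ℝ, E) 𝓘(ℝ, ℂ) ∞ f x) (hσ : IsSmoothAt σ x) (v : HTan E x) :
    dPrime S.D (fun y => f y • σ y) x v = f x • dPrime S.D σ x v + delFun f x v • σ x := by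
  simp only [dPrime, delFun, S.D_smul hf hσ]
  module

theorem dSecond_smul {f : M → ℂ} {σ : ∀ x : M, HTan E x} {x : M}
    (hf : ContMDiffAt 𝓘(ℝ, E) 𝓘(ℝ, ℂ) ∞ f x) (hσ : IsSmoothAt σ x) (v : HTan E x) :
    dSecond S.D (fun y => f y • σ y) x v =
      f x • dSecond S.D σ x v + delBarFun f x v • σ x := by
  simp only [dSecond, delBarFun, S.D_smul hf hσ]
  module

theorem dPrime_sum {ι : Type*} (t : Finset ι) {X : ι → ∀ x : M, HTan E x} {x : M}
    (h : ∀ i ∈ t, IsSmoothAt (X i) x) (v : HTan E x) :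
    dPrime S.D (fun y => ∑ i ∈ t, X i y) x v = ∑ i ∈ t, dPrime S.D (X i) x v := by
  simp only [dPrime, S.D_sum t h, Finset.smul_sum, ← Finset.sum_sub_distrib]

theorem dSecond_sum {ι : Type*} (t : Finset ι) {X : ι → ∀ x : M, HTan E x} {x : M}
    (h : ∀ i ∈ t, IsSmoothAt (X i) x) (v : HTan E x) :
    dSecond S.D (fun y => ∑ i ∈ t, X i y) x v = ∑ i ∈ t, dSecond S.D (X i) x v := by
  simp only [dSecond, S.D_sum t h, Finset.smul_sum, ← Finset.sum_add_distrib]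

theorem dPrime_congr {σ τ : ∀ x : M, HTan E x} {x : M} (hσ : IsSmoothAt σ x)
    (h : ∀ᶠ y in 𝓝 x, σ y = τ y) (v : HTan E x) : dPrime S.D σ x v = dPrime S.D τ x v := by
  simp only [dPrime, S.D_congr hσ h]

theorem dSecond_congr {σ τ : ∀ x : M, HTan E x} {x : M} (hσ : IsSmoothAt σ x)
    (h : ∀ᶠ y in 𝓝 x, σ y = τ y) (v : HTan E x) : dSecond S.D σ x v = dSecond S.D τ x v := by
  simp only [dSecond, S.D_congr hσ h]

end CDVStructure
end Connections

/-! ### Algebra of idempotent frames. -/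

theorem exists_sum_of_linearIndependent {V : Type*} [AddCommGroup V] [Module ℂ V]
    [FiniteDimensional ℂ V] {m : ℕ} {b : Fin m → V} (hb : LinearIndependent ℂ b)
    (hm : m = Module.finrank ℂ V) (v : V) : ∃ a : Fin m → ℂ, v = ∑ j, a j • b j := by
  have hv : v ∈ Submodule.span ℂ (Set.range b) := by
    rw [hb.span_eq_top_of_card_eq_finrank' (by simpa using hm)]
    exact Submodule.mem_top
  obtain ⟨a, ha⟩ := (Submodule.mem_span_range_iff_exists_fun ℂ).1 hv
  exact ⟨a, ha.symm⟩

section Frames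

variable {E : Type*} [NormedAddCommGroup E] [NormedSpace ℂ E]
  {M : Type*} [TopologicalSpace M] [ChartedSpace E M] [IsManifold 𝓘(ℂ, E) ω M]

namespace FrobeniusManifold

variable (F : FrobeniusManifold E M)

/-- A holomorphic frame of orthogonal idempotents on the open set `O`. -/
structure IsIdempotentFrameOn {m : ℕ} (e : Fin m → ∀ x : M, HTan E x) (O : Set M) : Prop where
  isOpen : IsOpen O
  hol : ∀ i, ∀ x ∈ O, IsHolAt (e i) x
  mul : ∀ x ∈ O, ∀ i j, F.mul x (e i x) (e j x) = if i = j then e i x else 0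
  ne_zero : ∀ x ∈ O, ∀ i, e i x ≠ 0
  card : m = Module.finrank ℂ E

/-- The coefficient of a vector with respect to `e i` in an idempotent frame. -/
def coeff {m : ℕ} (e : Fin m → ∀ x : M, HTan E x) (i : Fin m) (x : M) : HTan E x →ₗ[ℂ] ℂ :=
  (F.metric x (e i x) (e i x))⁻¹ • F.metric x (e i x)

/-- The `i`-th eigenvalue of `𝓤` in an idempotent frame. -/
def eig {m : ℕ} (e : Fin m → ∀ x : M, HTan E x) (i : Fin m) (x : M) : ℂ :=
  F.coeff e i x (F.euler x)

namespace IsIdempotentFrameOn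

variable {F} {m : ℕ} {e : Fin m → ∀ x : M, HTan E x} {O : Set M}
  (h : F.IsIdempotentFrameOn e O) {x : M} (hx : x ∈ O)

include h hx

theorem mul_self (i : Fin m) : F.mul x (e i x) (e i x) = e i x := by
  rw [h.mul x hx, if_pos rfl]

theorem mul_of_ne {i j : Fin m} (hij : i ≠ j) : F.mul x (e i x) (e j x) = 0 := by
  rw [h.mul x hx, if_neg hij]

theorem mem_nhds : O ∈ 𝓝 x := h.isOpen.mem_nhds hx

theorem mul_sum (i : Fin m) (a : Fin m → ℂ) :
    F.mul x (e i x) (∑ j, a j • e j x) = a i • e i x := by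
  rw [map_sum, Finset.sum_eq_single i]
  · rw [map_smul, h.mul_self hx]
  · intro j _ hj
    rw [map_smul, h.mul_of_ne hx hj.symm, smul_zero]
  · simp

theorem linearIndependent : LinearIndependent ℂ (fun i => (e i x : HTan E x)) := by
  rw [Fintype.linearIndependent_iff]
  intro a ha i
  have h1 := h.mul_sum hx i a
  rw [ha, map_zero] at h1
  exact (smul_eq_zero.1 h1.symm).resolve_right (h.ne_zero x hx i)

theorem exists_sum [FiniteDimensional ℂ E] (v : HTan E x) :
    ∃ a : Fin m → ℂ, v = ∑ j, a j • e j x := by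
  have hli : LinearIndependent ℂ (M := E) (fun i => (e i x : HTan E x)) :=
    h.linearIndependent hx
  exact exists_sum_of_linearIndependent hli h.card v

/-- Invariance gives `g(e_i, e_j) = g(e_i ∘ e_i, e_j) = g(e_i, e_i ∘ e_j)`. This orthogonality is
why `coeff`, defined through `g`, is the dual frame. -/
theorem metric_of_ne {i j : Fin m} (hij : i ≠ j) : F.metric x (e i x) (e j x) = 0 := by
  conv_lhs => rw [← h.mul_self hx i]
  rw [F.metric_mul, h.mul_of_ne hx hij, map_zero]

theorem metric_self_ne_zero [FiniteDimensional ℂ E] (i : Fin m) :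
    F.metric x (e i x) (e i x) ≠ 0 := by
  intro h0
  refine h.ne_zero x hx i (F.metric_nondegenerate x _ fun w => ?_)
  obtain ⟨a, rfl⟩ := h.exists_sum hx w
  rw [map_sum]
  refine Finset.sum_eq_zero fun j _ => ?_
  rw [map_smul]
  by_cases hij : i = j
  · subst hij; rw [h0, smul_zero]
  · rw [h.metric_of_ne hx hij, smul_zero]

theorem coeff_of_ne {i j : Fin m} (hij : i ≠ j) : F.coeff e i x (e j x) = 0 := by
  rw [coeff, LinearMap.smul_apply, h.metric_of_ne hx hij, smul_zero]

variable [FiniteDimensional ℂ E]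

theorem coeff_self (i : Fin m) : F.coeff e i x (e i x) = 1 := by
  rw [coeff, LinearMap.smul_apply, smul_eq_mul, inv_mul_cancel₀ (h.metric_self_ne_zero hx i)]

theorem coeff_sum (i : Fin m) (a : Fin m → ℂ) : F.coeff e i x (∑ j, a j • e j x) = a i := by
  rw [map_sum, Finset.sum_eq_single i]
  · rw [map_smul, h.coeff_self hx, smul_eq_mul, mul_one]
  · intro j _ hj
    rw [map_smul, h.coeff_of_ne hx hj.symm, smul_zero]
  · simp

theorem sum_coeff (v : HTan E x) : ∑ j, F.coeff e j x v • e j x = v := by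
  obtain ⟨a, rfl⟩ := h.exists_sum hx v
  simp only [h.coeff_sum hx]

theorem ext_coeff {v w : HTan E x} (hvw : ∀ j, F.coeff e j x v = F.coeff e j x w) : v = w := by
  rw [← h.sum_coeff hx v, ← h.sum_coeff hx w]
  simp only [hvw]

theorem eq_smul_of_coeff {v : HTan E x} {i : Fin m}
    (hv : ∀ j, j ≠ i → F.coeff e j x v = 0) : v = F.coeff e i x v • e i x := by
  conv_lhs => rw [← h.sum_coeff hx v]
  refine Finset.sum_eq_single i (fun j _ hj => ?_) (by simp)
  rw [hv j hj, zero_smul]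

theorem frame_mul (i : Fin m) (v : HTan E x) :
    F.mul x (e i x) v = F.coeff e i x v • e i x := by
  conv_lhs => rw [← h.sum_coeff hx v]
  rw [h.mul_sum hx]

theorem mul_frame (i : Fin m) (v : HTan E x) :
    F.mul x v (e i x) = F.coeff e i x v • e i x := by
  rw [F.mul_comm, h.frame_mul hx]

/-- Multiplication by `e_i` projects to the line of `e_i`, so `coeff e i x` is a character of the
tangent algebra. Hence `𝓤` and `Φ` are diagonal. -/
theorem coeff_mul (i : Fin m) (v w : HTan E x) :
    F.coeff e i x (F.mul x v w) = F.coeff e i x v * F.coeff e i x w := by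
  have h1 := h.frame_mul hx i (F.mul x v w)
  rw [← F.mul_assoc, h.frame_mul hx, LinearMap.map_smul₂, h.frame_mul hx, smul_smul] at h1
  exact (smul_left_injective ℂ (h.ne_zero x hx i) h1).symm

theorem U_frame (i : Fin m) : F.U x (e i x) = F.eig e i x • e i x := h.mul_frame hx i _

theorem higgs_frame (i : Fin m) (v : HTan E x) :
    F.higgs x v (e i x) = -(F.coeff e i x v • e i x) := by
  rw [higgs, LinearMap.neg_apply, h.mul_frame hx]

theorem coeff_U (i : Fin m) (v : HTan E x) :
    F.coeff e i x (F.U x v) = F.eig e i x * F.coeff e i x v := h.coeff_mul hx i _ _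

theorem coeff_higgs (i : Fin m) (v w : HTan E x) :
    F.coeff e i x (F.higgs x v w) = -(F.coeff e i x v * F.coeff e i x w) := by
  rw [higgs, LinearMap.neg_apply, map_neg, h.coeff_mul hx]

theorem sum_frame : ∑ i, e i x = F.unit x := by
  refine h.ext_coeff hx fun j => ?_
  have h1 := h.mul_frame hx j (F.unit x)
  rw [F.unit_mul] at h1
  have h2 : F.coeff e j x (F.unit x) = 1 :=
    smul_left_injective ℂ (h.ne_zero x hx j) (by simpa using h1.symm)
  have h3 := h.coeff_sum hx j (fun _ => 1)
  simp only [one_smul] at h3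
  rw [h2, h3]

theorem coeff_hol (i : Fin m) {X : ∀ x : M, HTan E x} (hX : IsHolAt X x) :
    ContMDiffAt 𝓘(ℂ, E) 𝓘(ℂ, ℂ) ω (fun y => F.coeff e i y (X y)) x := by
  have h1 := F.metric_holomorphic x _ _ (h.hol i x hx) (h.hol i x hx)
  have h2 := F.metric_holomorphic x _ _ (h.hol i x hx) hX
  exact (h1.inv₀ (h.metric_self_ne_zero hx i)).mul h2

theorem eig_hol (i : Fin m) : ContMDiffAt 𝓘(ℂ, E) 𝓘(ℂ, ℂ) ω (F.eig e i) x :=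
  h.coeff_hol hx i (F.euler_holomorphic x)

theorem coeff_smooth_prod (i : Fin m) {s : ℂ → ∀ x : M, HTan E x} {z : ℂ}
    (hs : IsSmoothAtProd s z x) :
    ContMDiffAt (𝓘(ℝ, ℂ).prod 𝓘(ℝ, E)) 𝓘(ℝ, ℂ) ∞
      (fun p : ℂ × M => F.coeff e i p.2 (s p.1 p.2)) (z, x) := by
  have h1 := (F.metric_holomorphic x _ _ (h.hol i x hx) (h.hol i x hx)).inv₀
    (h.metric_self_ne_zero hx i)
  have h2 := F.metric_smooth_prod hs (h.hol i x hx)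
  have h3 := (contMDiffAt_real_of_complex h1).comp (z, x)
    (contMDiffAt_snd (I := 𝓘(ℝ, ℂ)) (J := 𝓘(ℝ, E)))
  have h4 := ContMDiffAt.complex_smul h3 h2
  simp only [F.metric_symm _ _ (e i _)] at h4
  exact h4

/-- An eigenvector has some nonzero coefficient, so every given eigenvalue `μ k` equals some `eig`.
The resulting self-map of the finite index set is injective, hence a permutation. -/
theorem eig_injective (hss : F.IsSemisimple) : Function.Injective fun i => F.eig e i x := by
  obtain ⟨μ, hμ, heig⟩ := hss x
  have hc := h.card
  subst hc
  have hex : ∀ k, ∃ i, F.eig e i x = μ k := by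
    intro k
    obtain ⟨v, hv⟩ := (heig k).exists_hasEigenvector
    by_contra! hne
    refine hv.2 (h.ext_coeff hx fun j => ?_)
    have h1 := congrArg (F.coeff e j x) hv.apply_eq_smul
    rw [h.coeff_U hx, map_smul, smul_eq_mul] at h1
    have h2 : (F.eig e j x - μ k) * F.coeff e j x v = 0 := by rw [sub_mul, h1, sub_self]
    rw [map_zero]
    exact (mul_eq_zero.1 h2).resolve_left (sub_ne_zero.2 (hne j))
  choose σ hσ using hex
  have hinj : Function.Injective ((fun i => F.eig e i x) ∘ σ) := by
    intro a b hab
    exact hμ (by simpa [hσ] using hab)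
  have hσinj : Function.Injective σ := hinj.of_comp
  have hσsurj := Finite.surjective_of_injective hσinj
  intro i j hij
  obtain ⟨a, rfl⟩ := hσsurj i
  obtain ⟨b, rfl⟩ := hσsurj j
  exact congrArg σ (hinj hij)

end IsIdempotentFrameOn
end FrobeniusManifold
end Frames

/-! ### The Chern connection on an idempotent frame. -/

section FlatChern

variable {E : Type*} [NormedAddCommGroup E] [NormedSpace ℂ E]
  {M : Type*} [TopologicalSpace M] [ChartedSpace E M] [IsManifold 𝓘(ℂ, E) ω M]

namespace CDVStructure

variable {S : CDVStructure E M}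

theorem eq_zero_of_herm_self (hpos : S.IsPositive) {x : M} {v : HTan E x}
    (hv : S.herm x v v = 0) : v = 0 := by
  by_contra hne
  have := hpos x v hne
  rw [hv] at this
  simp at this

/-- Torsion-freeness turns `∇_𝓔 X - [𝓔, X]` into `∇_X 𝓔`. -/
theorem V_eq_Q (hDn : S.DPrimeEqNabla) (x : M) : S.V x = S.Q x := by
  ext v
  have hX := isHolAt_ofCoord x (coord x x v)
  have h1 := S.Q_eq x _ hX
  have h2 := S.nabla_torsion x S.euler _ (S.euler_holomorphic x) hX
  rw [hDn x _ hX, ← h2] at h1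
  rw [ofCoord_coord (mem_of_mem_nhds (coordDomain_mem_nhds x))] at h1
  rw [h1, FrobeniusManifold.V]
  simp

variable [FiniteDimensional ℂ E]

section

variable {m : ℕ} {e : Fin m → ∀ x : M, HTan E x} {O : Set M}
  (h : S.IsIdempotentFrameOn e O) {x : M} (hx : x ∈ O)

include h hx

theorem dPrime_U_frame (hD : ∀ i, ∀ v : HTan E x, S.D (e i) x v = 0) (i : Fin m) (v : HTan E x) :
    dPrime S.D (fun y => S.U y (e i y)) x v =
      (mvfderiv 𝓘(ℂ, E) (S.eig e i) x v : ℂ) • e i x := by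
  have hs := (h.hol i x hx).isSmoothAt
  have hu := h.eig_hol hx i
  rw [← S.dPrime_congr (σ := fun y => S.eig e i y • e i y)
    (IsSmoothAt.smul (contMDiffAt_real_of_complex hu) hs)
    (by filter_upwards [h.mem_nhds hx] with y hy using (h.U_frame hy i).symm),
    S.dPrime_smul (contMDiffAt_real_of_complex hu) hs, delFun_of_hol hu,
    ← S.D_eq_dPrime (h.hol i x hx), hD, smul_zero, zero_add]

/-- This is the `(j, i)` entry of the equation for `D'(𝓤)`. The diagonal entries determine `du_i`,
and the others determine the off-diagonal part of `𝓠`. -/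
theorem coeff_Q_frame (hD : ∀ i, ∀ v : HTan E x, S.D (e i) x v = 0) (i j : Fin m) (v : HTan E x) :
    mvfderiv 𝓘(ℂ, E) (S.eig e i) x v * S.coeff e j x (e i x)
      + (S.coeff e j x v - S.coeff e i x v) * S.coeff e j x (S.Q x (e i x))
      - S.coeff e i x v * S.coeff e j x (e i x) = 0 := by
  have h1 := congrArg (S.coeff e j x) (S.D_U x (e i) (h.hol i x hx).isSmoothAt v)
  rw [dPrime_U_frame h hx hD, ← S.D_eq_dPrime (h.hol i x hx), hD, h.higgs_frame hx] at h1
  simp only [map_sub, map_add, map_neg, map_smul, map_zero, smul_eq_mul,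
    h.coeff_higgs hx] at h1
  linear_combination h1

theorem mvfderiv_eig (hD : ∀ i, ∀ v : HTan E x, S.D (e i) x v = 0) (i : Fin m) (v : HTan E x) :
    mvfderiv 𝓘(ℂ, E) (S.eig e i) x v = S.coeff e i x v := by
  have h1 := coeff_Q_frame h hx hD i i v
  rw [h.coeff_self hx] at h1
  linear_combination h1

theorem Q_eq_zero_of_frame (hD : ∀ i, ∀ v : HTan E x, S.D (e i) x v = 0) : S.Q x = 0 := by
  have hoff : ∀ i j, j ≠ i → S.coeff e j x (S.Q x (e i x)) = 0 := by
    intro i j hij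
    -- In the direction `e_j` the factor in front of the entry of `𝓠` is `1`.
    have h1 := coeff_Q_frame h hx hD i j (e j x)
    rw [h.coeff_of_ne hx hij, h.coeff_of_ne hx hij.symm, h.coeff_self hx] at h1
    linear_combination h1
  have hQ : ∀ i, S.Q x (e i x) = 0 := by
    intro i
    have h1 := h.eq_smul_of_coeff hx (hoff i)
    -- Skewness makes `g(𝓠 e_i, e_i)` equal to its own negative.
    have h2 := S.Q_skew x (e i x) (e i x)
    rw [h1, LinearMap.map_smul₂, map_smul, smul_eq_mul] at h2
    have h3 : S.coeff e i x (S.Q x (e i x)) = 0 := by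
      refine (mul_eq_zero.1 ?_).resolve_right (h.metric_self_ne_zero hx i)
      linear_combination (1 / 2) * h2
    rw [h1, h3, zero_smul]
  ext v
  rw [← h.sum_coeff hx v, map_sum]
  simp only [map_smul, hQ, smul_zero, Finset.sum_const_zero, LinearMap.zero_apply]

/-- On `(e_i, ē_j)` applied to `e_k`, the left side of `tt_star` is zero: `D'' e_k = 0`, and
`D'_{e_i} e_k = ∇_{e_i} e_k` is again holomorphic. -/
theorem higgs_comm_higgsDagger (hDn : S.DPrimeEqNabla) (i j : Fin m) (v : HTan E x) :
    S.higgs x (e i x) (S.higgsDagger x (e j x) v) =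
      S.higgsDagger x (e j x) (S.higgs x (e i x) v) := by
  have hk : ∀ k, S.higgs x (e i x) (S.higgsDagger x (e j x) (e k x)) =
      S.higgsDagger x (e j x) (S.higgs x (e i x) (e k x)) := by
    intro k
    have h1 := S.tt_star x (e i) (e j) (e k) (h.hol i x hx) (h.hol j x hx)
      (h.hol k x hx).isSmoothAt
    have h2 : dPrime S.D (fun y => dSecond S.D (e k) y (e j y)) x (e i x) = 0 := by
      rw [← S.dPrime_congr (σ := fun _ => 0) (isHolAt_zero x).isSmoothAt]
      · simp only [dPrime, S.D_zero, smul_zero, sub_zero]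
      · filter_upwards [h.mem_nhds hx] with y hy using (S.D_dbar y _ (h.hol k y hy) _).symm
    have h3 : dSecond S.D (fun y => dPrime S.D (e k) y (e i y)) x (e j x) = 0 := by
      have hn := S.nabla_holomorphic x (e i) (e k) (h.hol i x hx) (h.hol k x hx)
      rw [← S.dSecond_congr hn.isSmoothAt, S.D_dbar x _ hn]
      filter_upwards [h.mem_nhds hx] with y hy using (hDn y _ (h.hol k y hy) _).symm
    rw [h2, h3, sub_zero, eq_comm, neg_eq_zero, sub_eq_zero] at h1
    exact h1
  rw [← h.sum_coeff hx v]
  simp only [map_sum, map_smul, hk]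

/-- By normality `‖Φ†e_j‖² = h(Φ Φ†e_j, e_j) = h(Φ†Φ e_j, e_j) = 0` for `Φ = Φ_{e_i}`, since `e_i ∘
e_j = 0`. Moving `Φ` across `h` then gives `h(e_i, e_j) = -h(Φ e_i, e_j) = -h(e_i, Φ†e_j) = 0`. -/
theorem herm_frame_of_ne (hpos : S.IsPositive) (hDn : S.DPrimeEqNabla) {i j : Fin m}
    (hij : i ≠ j) : S.herm x (e i x) (e j x) = 0 := by
  have hw : S.higgsDagger x (e i x) (e j x) = 0 := by
    apply eq_zero_of_herm_self hpos
    rw [← S.herm_higgs, higgs_comm_higgsDagger h hx hDn, h.higgs_frame hx,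
      h.coeff_of_ne hx hij.symm, zero_smul, neg_zero, map_zero]
    simp [herm]
  have h1 := S.herm_higgs x (e i x) (e i x) (e j x)
  rw [hw, h.higgs_frame hx, h.coeff_self hx, one_smul] at h1
  simpa [herm] using h1

theorem kappa_frame (hpos : S.IsPositive) (hDn : S.DPrimeEqNabla) (j : Fin m) :
    S.kappa x (e j x) = S.coeff e j x (S.kappa x (e j x)) • e j x := by
  refine h.eq_smul_of_coeff hx fun i hij => ?_
  have h1 := herm_frame_of_ne h hx hpos hDn hij
  rw [herm] at h1
  rw [FrobeniusManifold.coeff, LinearMap.smul_apply, h1, smul_zero]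

/-- `κ` preserves the line of `e_j` and is antilinear, so eigenvalues of diagonal operators get
conjugated. -/
theorem conjEnd_frame (hpos : S.IsPositive) (hDn : S.DPrimeEqNabla) {A : HTan E x →ₗ[ℂ] HTan E x}
    {j : Fin m} {c : ℂ} (hA : A (e j x) = c • e j x) :
    conjEnd (S.kappa x) A (e j x) = conj c • e j x := by
  have h1 := kappa_frame h hx hpos hDn j
  simp only [conjEnd, LinearMap.comp_apply]
  have h2 : A (S.kappa x (e j x)) = c • S.kappa x (e j x) := by
    rw [h1, map_smul, hA, smul_comm]
  rw [h2, LinearMap.map_smulₛₗ, S.kappa_kappa]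

theorem coeff_eq_of_frame {A : HTan E x →ₗ[ℂ] HTan E x} {c : Fin m → ℂ}
    (hA : ∀ j, A (e j x) = c j • e j x) (i : Fin m) (v : HTan E x) :
    S.coeff e i x (A v) = c i * S.coeff e i x v := by
  conv_lhs => rw [← h.sum_coeff hx v, map_sum]
  simp only [map_smul, hA, smul_smul]
  rw [h.coeff_sum hx, mul_comm]

theorem coeff_UDagger (hpos : S.IsPositive) (hDn : S.DPrimeEqNabla) (i : Fin m) (v : HTan E x) :
    S.coeff e i x (S.UDagger x v) = conj (S.eig e i x) * S.coeff e i x v :=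
  coeff_eq_of_frame h hx (c := fun i => conj (S.eig e i x))
    (fun j => conjEnd_frame h hx hpos hDn (h.U_frame hx j)) i v

theorem coeff_higgsDagger (hpos : S.IsPositive) (hDn : S.DPrimeEqNabla) (i : Fin m)
    (v w : HTan E x) :
    S.coeff e i x (S.higgsDagger x v w) = -(conj (S.coeff e i x v) * S.coeff e i x w) := by
  have h1 := coeff_eq_of_frame h hx (c := fun i => conj (-S.coeff e i x v))
    (fun j => conjEnd_frame h hx hpos hDn (A := S.higgs x v) (c := -S.coeff e j x v)
      (by rw [h.higgs_frame hx, neg_smul])) i w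
  rw [higgsDagger, h1, map_neg, neg_mul]

theorem D_frame (hpos : S.IsPositive) (hDn : S.DPrimeEqNabla) (i : Fin m) (v : HTan E x) :
    S.D (e i) x v = 0 := by
  have hoff : ∀ i j, j ≠ i → S.coeff e j x (S.D (e i) x v) = 0 := by
    intro i j hij
    -- This is the derivative of `h(e_i, e_j) = 0`.
    have hz : ∀ w : HTan E x, S.metric x (S.D (e i) x w) (S.kappa x (e j x))
        + S.metric x (e i x) (S.kappa x (S.D (e j) x w)) = 0 := by
      intro w
      rw [← S.D_hermitian x (e i) (e j) (h.hol i x hx).isSmoothAt (h.hol j x hx).isSmoothAt w]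
      rw [mvfderiv_congr (g := fun _ => (0 : ℂ))]
      · rw [mvfderiv_const]; rfl
      · filter_upwards [h.mem_nhds hx] with y hy using herm_frame_of_ne h hy hpos hDn hij.symm
    have h1 := hz v
    -- The first term of `hz` is linear in the direction and the second antilinear, so comparing `v`
    -- with `i v` makes each vanish.
    have h2 := hz (Complex.I • v : HTan E x)
    rw [S.D_I_smul (h.hol i x hx), S.D_I_smul (h.hol j x hx), (S.kappa x).map_smulₛₗ,
      LinearMap.map_smul₂ (S.metric x), map_smul, Complex.conj_I, smul_eq_mul, smul_eq_mul] at h2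
    have h3 : S.metric x (S.D (e i) x v) (S.kappa x (e j x)) = 0 := by
      linear_combination (1 / 2) * h1 - (Complex.I / 2) * h2 +
        (1 / 2) * (S.metric x (S.D (e i) x v) (S.kappa x (e j x))
          - S.metric x (e i x) (S.kappa x (S.D (e j) x v))) * Complex.I_mul_I
    rw [kappa_frame h hx hpos hDn, map_smul, smul_eq_mul] at h3
    have hb : S.coeff e j x (S.kappa x (e j x)) ≠ 0 := by
      intro hb
      have h5 := kappa_frame h hx hpos hDn j
      rw [hb, zero_smul] at h5
      apply h.ne_zero x hx j
      rw [← S.kappa_kappa x (e j x), h5, map_zero]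
    rw [FrobeniusManifold.coeff, LinearMap.smul_apply,
      S.metric_symm x (e j x) (S.D (e i) x v),
      (mul_eq_zero.1 h3).resolve_left hb, smul_zero]
  have hdiag : ∀ i, S.D (e i) x v = S.coeff e i x (S.D (e i) x v) • e i x := fun i =>
    h.eq_smul_of_coeff hx (hoff i)
  -- The unit `∑ e_i` is `∇`-flat and `D' = ∇`, so the diagonal coefficients of `D e_i` vanish one
  -- by one.
  have hsum : ∑ i, S.D (e i) x v = 0 := by
    rw [← S.D_sum Finset.univ fun i _ => (h.hol i x hx).isSmoothAt]
    have hu := S.unit_holomorphic x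
    have h6 : S.D S.unit x = S.D (fun y => ∑ i, e i y) x := S.D_congr hu.isSmoothAt (by
      filter_upwards [h.mem_nhds hx] with y hy using (h.sum_frame hy).symm)
    rw [← h6, S.D_eq_dPrime hu, hDn x _ hu, S.nabla_unit]
    rfl
  rw [Finset.sum_congr rfl fun i _ => hdiag i] at hsum
  have h7 := h.coeff_sum hx i fun i => S.coeff e i x (S.D (e i) x v)
  rw [hsum, map_zero] at h7
  rw [hdiag i, ← h7, zero_smul]

theorem nabla_frame (hpos : S.IsPositive) (hDn : S.DPrimeEqNabla) (i : Fin m) :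
    S.nabla (e i) x = 0 := by
  ext v
  rw [← hDn x _ (h.hol i x hx), ← S.D_eq_dPrime (h.hol i x hx), D_frame h hx hpos hDn]
  rfl

end

/-- If `𝓠 = 0` and `∇ e i = 0` for an idempotent frame, then `D e i = 0`. -/
theorem D_frame_of_tate {m : ℕ} {e : Fin m → ∀ x : M, HTan E x} {O : Set M}
    (h : S.IsIdempotentFrameOn e O) {x : M} (hx : x ∈ O) (hss : S.IsSemisimple)
    (hT : S.IsTate) (hflat : ∀ i, S.nabla (e i) x = 0) (i : Fin m) (v : HTan E x) :
    S.D (e i) x v = 0 := by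
  have hs := (h.hol i x hx).isSmoothAt
  have hu := h.eig_hol hx i
  have hU : dPrime S.D (fun y => S.U y (e i y)) x v =
      S.eig e i x • S.D (e i) x v + (mvfderiv 𝓘(ℂ, E) (S.eig e i) x v : ℂ) • e i x := by
    rw [← S.dPrime_congr (σ := fun y => S.eig e i y • e i y)
      (IsSmoothAt.smul (contMDiffAt_real_of_complex hu) hs)
      (by filter_upwards [h.mem_nhds hx] with y hy using (h.U_frame hy i).symm),
      S.dPrime_smul (contMDiffAt_real_of_complex hu) hs, delFun_of_hol hu,
      ← S.D_eq_dPrime (h.hol i x hx)]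
  -- With `𝓠 = 0`, the off-diagonal entries of the equation for `D'(𝓤)` read `(u_i - u_j) ·
  -- coeff_j(D e_i) = 0`.
  have hoff : ∀ j, j ≠ i → S.coeff e j x (S.D (e i) x v) = 0 := by
    intro j hij
    have h1 := congrArg (S.coeff e j x) (S.D_U x (e i) hs v)
    rw [hU, hT x, ← S.D_eq_dPrime (h.hol i x hx), h.higgs_frame hx] at h1
    simp only [map_sub, map_add, map_neg, map_smul, map_zero, smul_eq_mul,
      h.coeff_U hx, h.coeff_of_ne hx hij, LinearMap.zero_apply] at h1
    have h2 : (S.eig e i x - S.eig e j x) * S.coeff e j x (S.D (e i) x v) = 0 := by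
      linear_combination h1
    refine (mul_eq_zero.1 h2).resolve_left (sub_ne_zero.2 fun hij' => hij ?_)
    exact (h.eig_injective hx hss hij').symm
  have hdiag := h.eq_smul_of_coeff hx hoff
  -- Taking `κ e_i` as the second argument of `h` turns `D h = 0`, together with `D κ = 0`, into `D
  -- g = 0`.
  have h3 := S.D_hermitian x (e i) (fun y => S.kappa y (e i y)) hs (S.kappa_smooth x _ hs) v
  simp only [S.kappa_kappa] at h3
  rw [S.D_kappa x _ hs, S.kappa_kappa, mvfderiv_real_of_complex
    ((S.metric_holomorphic x _ _ (h.hol i x hx) (h.hol i x hx)).mdifferentiableAt (by simp)),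
    S.nabla_metric x _ _ (h.hol i x hx) (h.hol i x hx), hflat] at h3
  have h4 : S.metric x (S.D (e i) x v) (e i x) = 0 := by
    have h5 : (0 : HTan E x →L[ℂ] HTan E x) v = 0 := rfl
    have h6 := S.metric_symm x (e i x) (S.D (e i) x v)
    have h7 : S.metric x (e i x) (0 : HTan E x) = 0 := map_zero _
    rw [h5, map_zero, LinearMap.zero_apply, h7] at h3
    linear_combination (-1 / 2) * h3 - (1 / 2) * h6
  rw [hdiag, FrobeniusManifold.coeff, LinearMap.smul_apply,
    S.metric_symm x (e i x) (S.D (e i) x v), h4, smul_zero, zero_smul]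

end CDVStructure
end FlatChern

/-! ### Derivatives in `z` on a fixed fibre. -/

section Wirtinger

variable {E : Type*} [NormedAddCommGroup E] [NormedSpace ℂ E]

theorem fderiv_real_of_hasDerivAt {f : ℂ → E} {f' : E} {z : ℂ} (hf : HasDerivAt f f' z) (a : ℂ) :
    fderiv ℝ f z a = a • f' := by
  rw [(hf.hasFDerivAt.restrictScalars ℝ).fderiv]
  simp

theorem partialZ_of_hasDerivAt {f : ℂ → E} {f' : E} {z : ℂ} (hf : HasDerivAt f f' z) :
    partialZ f z = f' := by
  simp only [partialZ, fderiv_real_of_hasDerivAt hf, smul_smul, Complex.I_mul_I]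
  module

theorem partialZBar_of_hasDerivAt {f : ℂ → E} {f' : E} {z : ℂ} (hf : HasDerivAt f f' z) :
    partialZBar f z = 0 := by
  simp only [partialZBar, fderiv_real_of_hasDerivAt hf, smul_smul, Complex.I_mul_I]
  module

variable {M : Type*} [TopologicalSpace M] [ChartedSpace E M] [IsManifold 𝓘(ℂ, E) ω M]

/-- The values at `x` of a section of the pull-back of the tangent bundle to `ℂ × M`. -/
def fiberCurve (s : ℂ → ∀ x : M, HTan E x) (x : M) : ℂ → E := fun w => s w x

/-- The complex derivative of `fiberCurve s x` at `z`. -/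
def fiberDeriv (s : ℂ → ∀ x : M, HTan E x) (z : ℂ) (x : M) : HTan E x :=
  deriv (F := E) (fiberCurve s x) z

theorem IsHolAtProd.differentiableAt {s : ℂ → ∀ x : M, HTan E x} {z : ℂ} {x : M}
    (h : IsHolAtProd s z x) : DifferentiableAt ℂ (fiberCurve s x) z := by
  rw [isHolAtProd_iff] at h
  have h1 : ContMDiffAt 𝓘(ℂ, ℂ) 𝓘(ℂ, E) ω (fun w => coord x x (s w x)) z :=
    ContMDiffAt.comp (f := fun w : ℂ => (w, x)) z h (contMDiffAt_id.prodMk contMDiffAt_const)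
  have h2 := h1.contDiffAt.differentiableAt (by simp)
  let A : E →L[ℂ] E := ofCoord x x
  have h3 := A.differentiableAt.comp z h2
  refine h3.congr_of_eventuallyEq (Filter.Eventually.of_forall fun w => ?_)
  exact (ofCoord_coord (mem_of_mem_nhds (coordDomain_mem_nhds x)) (s w x)).symm

theorem IsHolAtProd.hasDerivAt {s : ℂ → ∀ x : M, HTan E x} {z : ℂ} {x : M}
    (h : IsHolAtProd s z x) : HasDerivAt (F := E) (fiberCurve s x) (fiberDeriv s z x) z :=
  h.differentiableAt.hasDerivAt

theorem hasDerivAt_linearMap_comp [FiniteDimensional ℂ E] (L : E →ₗ[ℂ] ℂ) {t : ℂ → E} {t' : E}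
    {z : ℂ} (ht : HasDerivAt t t' z) : HasDerivAt (fun w => L (t w)) (L t') z :=
  (LinearMap.toContinuousLinearMap L).hasFDerivAt.comp_hasDerivAt z ht

end Wirtinger

/-! ### Diagonal exponentials are potentials. -/

section Potential

variable {E : Type*} [NormedAddCommGroup E] [NormedSpace ℂ E] [FiniteDimensional ℂ E]
  {M : Type*} [TopologicalSpace M] [ChartedSpace E M] [IsManifold 𝓘(ℂ, E) ω M]

namespace CDVStructure

variable {S : CDVStructure E M}

section

variable {m : ℕ} {e : Fin m → ∀ x : M, HTan E x} {O : Set M}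
  (h : S.IsIdempotentFrameOn e O) {x : M} (hx : x ∈ O)

include h hx

theorem mvfderiv_coeff_of_flat (hflat : ∀ y ∈ O, ∀ i, S.nabla (e i) y = 0)
    {X : ∀ x : M, HTan E x} (hX : IsHolAt X x) (i : Fin m) (v : HTan E x) :
    S.coeff e i x (S.nabla X x v) =
      mvfderiv 𝓘(ℂ, E) (fun y => S.coeff e i y (X y)) x v := by
  have h1 : S.nabla X x = S.nabla (fun y => ∑ j, S.coeff e j y (X y) • e j y) x :=
    S.nabla_congr hX (by
      filter_upwards [h.mem_nhds hx] with y hy using (h.sum_coeff hy _).symm)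
  have h3 : ∀ j ∈ Finset.univ, IsHolAt (fun y => S.coeff e j y (X y) • e j y) x := fun j _ =>
    IsHolAt.smul (h.coeff_hol hx j hX) (h.hol j x hx)
  rw [h1, S.nabla_sum Finset.univ h3]
  have h2 : ∀ j, S.nabla (fun y => S.coeff e j y (X y) • e j y) x v =
      (mvfderiv 𝓘(ℂ, E) (fun y => S.coeff e j y (X y)) x v : ℂ) • e j x := by
    intro j
    have h0 : (0 : HTan E x →L[ℂ] HTan E x) v = 0 := rfl
    rw [S.nabla_smul (h.coeff_hol hx j hX) (h.hol j x hx), hflat x hx, h0, smul_zero, zero_add]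
  simp only [h2]
  rw [h.coeff_sum hx]

end

/-- The frame and the constants may depend on the base point, so this serves both the construction
of a potential, where only local frames exist, and the global description in canonical coordinates.
-/
theorem isPotential_of_frames (hpos : S.IsPositive) (hDn : S.DPrimeEqNabla)
    {φ : ℂ → ∀ x : M, HTan E x ≃ₗ[ℂ] HTan E x}
    (hφ : ∀ x, ∃ (m : ℕ) (e : Fin m → ∀ x : M, HTan E x) (O : Set M) (k : Fin m → ℂ),
      S.IsIdempotentFrameOn e O ∧ x ∈ O ∧ ∀ z, ∀ y ∈ O, ∀ i,
        φ z y (e i y) = (k i * Complex.exp (z * conj (S.eig e i y))) • e i y) :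
    S.IsPotential φ := by
  have hexp : ∀ (s : ℂ → ∀ x : M, HTan E x) {m : ℕ} {e : Fin m → ∀ x : M, HTan E x}
      {O : Set M} {k : Fin m → ℂ}, S.IsIdempotentFrameOn e O →
      (∀ z, ∀ y ∈ O, ∀ i,
        φ z y (e i y) = (k i * Complex.exp (z * conj (S.eig e i y))) • e i y) →
      ∀ z, ∀ y ∈ O, φ z y (s z y) = ∑ i, ((k i * Complex.exp (z * conj (S.eig e i y))) *
        S.coeff e i y (s z y)) • e i y := by
    intro s m e O k h hk z y hy
    conv_lhs => rw [← h.sum_coeff hy (s z y), map_sum]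
    refine Finset.sum_congr rfl fun i _ => ?_
    rw [map_smul, hk z y hy, smul_smul, mul_comm]
  have hcoeff : ∀ {m : ℕ} {e : Fin m → ∀ x : M, HTan E x}
      {O : Set M} {k : Fin m → ℂ}, S.IsIdempotentFrameOn e O →
      (∀ z, ∀ y ∈ O, ∀ i,
        φ z y (e i y) = (k i * Complex.exp (z * conj (S.eig e i y))) • e i y) →
      ∀ z, ∀ y ∈ O, ∀ v i, S.coeff e i y (φ z y v) =
        (k i * Complex.exp (z * conj (S.eig e i y))) * S.coeff e i y v := by
    intro m e O k h hk z y hy v i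
    exact coeff_eq_of_frame h hy (A := (φ z y : HTan E y →ₗ[ℂ] HTan E y))
      (fun j => hk z y hy j) i v
  -- The complex derivative of `φ s` in `z` on one fibre yields both `∂_{z̄}(φ s) = 0` and the value
  -- of `∂_z(φ s)`.
  have hfib : ∀ (s : ℂ → ∀ x : M, HTan E x) (z : ℂ) (x : M), IsHolAtProd s z x →
      ∀ {m : ℕ} {e : Fin m → ∀ x : M, HTan E x}
      {O : Set M} {k : Fin m → ℂ}, S.IsIdempotentFrameOn e O → x ∈ O →
      (∀ z, ∀ y ∈ O, ∀ i,
        φ z y (e i y) = (k i * Complex.exp (z * conj (S.eig e i y))) • e i y) →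
      ∃ t : HTan E x, HasDerivAt (F := E) (fiberCurve (fun w y => φ w y (s w y)) x) t z ∧
        ∀ j, S.coeff e j x t =
        (k j * (Complex.exp (z * conj (S.eig e j x)) * conj (S.eig e j x))) *
          S.coeff e j x (s z x) + (k j * Complex.exp (z * conj (S.eig e j x))) *
          S.coeff e j x (fiberDeriv s z x) := by
    intro s z x hs m e O k h hx hk
    have h1 := hs.hasDerivAt
    let e' : Fin m → E := fun i => e i x
    have h2 : fiberCurve (fun w y => φ w y (s w y)) x = fun w =>
        ∑ i, ((k i * Complex.exp (w * conj (S.eig e i x))) *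
        S.coeff e i x (s w x)) • e' i := by
      funext w
      exact hexp s h hk w x hx
    refine ⟨∑ i, ((k i * (Complex.exp (z * conj (S.eig e i x)) * conj (S.eig e i x))) *
          S.coeff e i x (s z x) + (k i * Complex.exp (z * conj (S.eig e i x))) *
          S.coeff e i x (fiberDeriv s z x)) • e i x, ?_, fun j => h.coeff_sum hx j _⟩
    rw [h2]
    refine HasDerivAt.fun_sum (F := E) (A' := fun i => ((k i * (Complex.exp (z *
      conj (S.eig e i x)) * conj (S.eig e i x))) * S.coeff e i x (s z x) +
      (k i * Complex.exp (z * conj (S.eig e i x))) *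
      S.coeff e i x (fiberDeriv s z x)) • e' i) fun i _ => ?_
    refine HasDerivAt.smul_const ?_ _
    refine HasDerivAt.mul ?_ (hasDerivAt_linearMap_comp (E := E) (S.coeff e i x) h1)
    exact ((hasDerivAt_mul_const (conj (S.eig e i x))).cexp).const_mul (k i)
  refine ⟨?_, ?_, ?_, ?_, ?_⟩
  · intro s z x hs
    obtain ⟨m, e, O, k, h, hx, hk⟩ := hφ x
    have hsm := hs.isSmoothAtProd
    refine IsSmoothAtProd.congr (s := fun w y => ∑ i, ((k i * Complex.exp (w *
      conj (S.eig e i y))) * S.coeff e i y (s w y)) • e i y) ?_ ?_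
    · refine IsSmoothAtProd.sum Finset.univ fun i _ => ?_
      refine IsSmoothAtProd.smul (f := fun p : ℂ × M => (k i * Complex.exp (p.1 *
        conj (S.eig e i p.2))) * S.coeff e i p.2 (s p.1 p.2)) (s := fun _ => e i) ?_
        ((h.hol i x hx).isHolAtProd z).isSmoothAtProd
      refine ContMDiffAt.complex_smul (E := ℂ) ?_ (h.coeff_smooth_prod hx i hsm)
      have h1 : ContDiff ℝ ∞ (fun p : ℂ × ℂ => k i * Complex.exp (p.1 * conj p.2)) :=
        contDiff_const.mul (contDiff_fst.mul (Complex.conjCLE.contDiff.comp contDiff_snd)).cexp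
      have h2 : ContMDiffAt (𝓘(ℝ, ℂ).prod 𝓘(ℝ, E)) 𝓘(ℝ, ℂ × ℂ) ∞
          (fun p : ℂ × M => (p.1, S.eig e i p.2)) (z, x) :=
        contMDiffAt_fst.prodMk_space ((contMDiffAt_real_of_complex (h.eig_hol hx i)).comp (z, x)
          (contMDiffAt_snd (I := 𝓘(ℝ, ℂ)) (J := 𝓘(ℝ, E))))
      exact h1.contDiffAt.contMDiffAt.comp (z, x) h2
    · filter_upwards [continuousAt_snd.eventually (h.mem_nhds hx)] with p hp
      exact (hexp s h hk p.1 p.2 hp).symm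
  · intro s z x hs
    obtain ⟨m, e, O, k, h, hx, hk⟩ := hφ x
    obtain ⟨t, ht, -⟩ := hfib s z x hs h hx hk
    exact partialZBar_of_hasDerivAt (E := E) ht
  · intro s z x hs v
    obtain ⟨m, e, O, k, h, hx, hk⟩ := hφ x
    have hsl := hs.slice
    have hf : ∀ i, ContMDiffAt 𝓘(ℝ, E) 𝓘(ℝ, ℂ) ∞ (fun y => Complex.exp (z *
        conj (S.eig e i y))) x := fun i => contMDiffAt_exp_conj (h.eig_hol hx i) z
    have hc : ∀ i, ContMDiffAt 𝓘(ℝ, E) 𝓘(ℝ, ℂ) ∞ (fun y => k i * S.coeff e i y (s z y)) x :=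
      fun i => ContMDiffAt.complex_smul (E := ℂ) contMDiffAt_const
        (contMDiffAt_real_of_complex (h.coeff_hol hx i hsl))
    have hc' : ∀ i, ContMDiffAt 𝓘(ℂ, E) 𝓘(ℂ, ℂ) ω (fun y => k i * S.coeff e i y (s z y)) x :=
      fun i => contMDiffAt_const.mul (h.coeff_hol hx i hsl)
    have hsm := fun i => IsSmoothAt.smul (ContMDiffAt.complex_smul (E := ℂ) (hf i) (hc i))
      (h.hol i x hx).isSmoothAt
    -- Only the exponential is not holomorphic. Its `∂̄`-derivative carries the factor `z ·
    -- conj(du_i)`, and `du_i` is the coefficient functional by `mvfderiv_eig`; this cancels against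
    -- `z Φ†`.
    have h1 : dSecond S.D (fun y => φ z y (s z y)) x v = ∑ i, ((Complex.exp (z *
        conj (S.eig e i x)) * (z * conj (S.coeff e i x v))) *
        (k i * S.coeff e i x (s z x))) • e i x := by
      rw [← S.dSecond_congr (IsSmoothAt.sum Finset.univ fun i _ => hsm i),
        S.dSecond_sum Finset.univ fun i _ => hsm i]
      · refine Finset.sum_congr rfl fun i _ => ?_
        rw [S.dSecond_smul (ContMDiffAt.complex_smul (E := ℂ) (hf i) (hc i))
          (h.hol i x hx).isSmoothAt, S.D_dbar x _ (h.hol i x hx), smul_zero, zero_add]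
        simp only [smul_eq_mul]
        rw [delBarFun_mul (hf i) (hc i), delBarFun_of_hol (hc' i),
          delBarFun_exp_conj (h.eig_hol hx i), mul_zero, zero_add,
          mvfderiv_eig h hx (fun i v => D_frame h hx hpos hDn i v)]
      · filter_upwards [h.mem_nhds hx] with y hy
        rw [hexp s h hk z y hy]
        refine Finset.sum_congr rfl fun i _ => ?_
        rw [smul_eq_mul]
        ring_nf
    rw [dbarTilde, h1]
    refine h.ext_coeff hx fun j => ?_
    rw [map_add, h.coeff_sum hx, map_smul, coeff_higgsDagger h hx hpos hDn,
      hcoeff h hk z x hx, map_zero, smul_eq_mul]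
    ring
  · intro s z x hs hz
    obtain ⟨m, e, O, k, h, hx, hk⟩ := hφ x
    have hQ := Q_eq_zero_of_frame h hx fun i v => D_frame h hx hpos hDn i v
    have h1 : partialZSec s z x = fiberDeriv s z x :=
      partialZ_of_hasDerivAt (E := E) hs.hasDerivAt
    obtain ⟨t, ht, htc⟩ := hfib s z x hs h hx hk
    have h2 : partialZSec (fun w y => φ w y (s w y)) z x = t := partialZ_of_hasDerivAt (E := E) ht
    -- Here `𝓥 = 𝓠 = 0`, and the factor `ū_i` from differentiating the exponential in `z` cancels
    -- `𝓤†`.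
    rw [FrobeniusManifold.nablaTildeZ, DTildeZ, V_eq_Q hDn, hQ, h1, h2]
    refine h.ext_coeff hx fun j => ?_
    rw [hcoeff h hk z x hx]
    simp only [map_add, map_sub, map_smul, h.coeff_U hx, coeff_UDagger h hx hpos hDn,
      hcoeff h hk z x hx, LinearMap.zero_apply, map_zero, smul_eq_mul, htc j]
    field_simp
    ring
  · intro s z x hs hz v
    obtain ⟨m, e, O, k, h, hx, hk⟩ := hφ x
    have hsl := hs.slice
    have hf : ∀ i, ContMDiffAt 𝓘(ℝ, E) 𝓘(ℝ, ℂ) ∞ (fun y => Complex.exp (z *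
        conj (S.eig e i y))) x := fun i => contMDiffAt_exp_conj (h.eig_hol hx i) z
    have hc0 : ∀ i, ContMDiffAt 𝓘(ℝ, E) 𝓘(ℝ, ℂ) ∞ (fun y => S.coeff e i y (s z y)) x :=
      fun i => contMDiffAt_real_of_complex (h.coeff_hol hx i hsl)
    have hc1 : ∀ i, ContMDiffAt 𝓘(ℝ, E) 𝓘(ℝ, ℂ) ∞ (fun _ : M => k i) x :=
      fun i => contMDiffAt_const
    have hc : ∀ i, ContMDiffAt 𝓘(ℝ, E) 𝓘(ℝ, ℂ) ∞ (fun y => k i * S.coeff e i y (s z y)) x :=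
      fun i => ContMDiffAt.complex_smul (E := ℂ) (hc1 i) (hc0 i)
    have hsm := fun i => IsSmoothAt.smul (ContMDiffAt.complex_smul (E := ℂ) (hf i) (hc i))
      (h.hol i x hx).isSmoothAt
    -- The exponential is antiholomorphic in `u_i`, so `∂` passes through it.
    have h1 : dPrime S.D (fun y => φ z y (s z y)) x v = ∑ i, (Complex.exp (z *
        conj (S.eig e i x)) *
        (k i * mvfderiv 𝓘(ℂ, E) (fun y => S.coeff e i y (s z y)) x v)) • e i x := by
      rw [← S.dPrime_congr (IsSmoothAt.sum Finset.univ fun i _ => hsm i),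
        S.dPrime_sum Finset.univ fun i _ => hsm i]
      · refine Finset.sum_congr rfl fun i _ => ?_
        rw [S.dPrime_smul (ContMDiffAt.complex_smul (E := ℂ) (hf i) (hc i))
          (h.hol i x hx).isSmoothAt, ← S.D_eq_dPrime (h.hol i x hx), D_frame h hx hpos hDn,
          smul_zero, zero_add]
        simp only [smul_eq_mul]
        rw [delFun_mul (hf i) (hc i), delFun_exp_conj (h.eig_hol hx i),
          delFun_mul (hc1 i) (hc0 i), delFun_of_hol (h.coeff_hol hx i hsl),
          delFun_of_hol contMDiffAt_const, mvfderiv_const]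
        simp
      · filter_upwards [h.mem_nhds hx] with y hy
        rw [hexp s h hk z y hy]
        refine Finset.sum_congr rfl fun i _ => ?_
        rw [smul_eq_mul]
        ring_nf
    rw [FrobeniusManifold.nablaTilde, DTilde, h1]
    refine h.ext_coeff hx fun j => ?_
    rw [hcoeff h hk z x hx, map_add, map_add, h.coeff_sum hx, map_smul, map_smul,
      h.coeff_higgs hx, h.coeff_higgs hx, hcoeff h hk z x hx,
      mvfderiv_coeff_of_flat h hx (fun y hy i => nabla_frame h hy hpos hDn i) hsl]
    simp only [smul_eq_mul]
    ring

end CDVStructure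
end Potential

/-! ### Entire solutions in `z`, and local constancy on `M`. -/

section Analysis

variable {E : Type*} [NormedAddCommGroup E] [NormedSpace ℂ E]

theorem hasDerivAt_of_partialZBar {f : ℂ → E} {z : ℂ} (hf : DifferentiableAt ℝ f z)
    (h : partialZBar f z = 0) : HasDerivAt f (partialZ f z) z := by
  have h1 := hf.hasFDerivAt
  have h2 : fderiv ℝ f z Complex.I = Complex.I • fderiv ℝ f z 1 := by
    simp only [partialZBar, smul_eq_zero] at h
    have h3 := h.resolve_left (by norm_num)
    rw [eq_neg_of_add_eq_zero_left h3, smul_neg, smul_smul, Complex.I_mul_I]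
    simp
  have h4 : partialZ f z = fderiv ℝ f z 1 := by
    rw [partialZ, h2, smul_smul, Complex.I_mul_I]
    module
  refine hasFDerivAt_of_restrictScalars ℝ h1 ?_
  ext a
  have ha : a = a.re • (1 : ℂ) + a.im • Complex.I := by
    simp [Complex.re_add_im]
  conv_rhs => rw [ha, map_add, map_smul, map_smul, h2]
  simp only [ContinuousLinearMap.coe_restrictScalars',
    ContinuousLinearMap.toSpanSingleton_apply, h4]
  conv_lhs => rw [ha]
  rw [add_smul]
  simp only [← Complex.coe_smul, smul_eq_mul, mul_one, mul_smul]

/-- An entire solution of `f' = 0` on `ℂ ∖ {0}` is constant. -/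
theorem entire_const_of_deriv {f : ℂ → ℂ} (hf : Differentiable ℂ f)
    (h : ∀ z ≠ 0, deriv f z = 0) (z w : ℂ) : f z = f w := by
  refine is_const_of_deriv_eq_zero hf (fun x => ?_) z w
  -- The equation fails to say anything at the pole; density of the punctured plane supplies `z =
  -- 0`.
  have hc : Continuous (deriv f) := (hf.contDiff (n := 1)).continuous_deriv le_rfl
  have hd : Dense ({0}ᶜ : Set ℂ) := dense_compl_singleton 0
  exact congrFun (hc.ext_on hd continuous_const fun y hy => h y hy) x

/-- An entire solution of the irregular singular equation `z² f' = c f`, `c ≠ 0`, vanishes. -/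
theorem entire_eq_zero_of_irregular {f : ℂ → ℂ} (hf : Differentiable ℂ f) {c : ℂ} (hc : c ≠ 0)
    (h : ∀ z ≠ 0, deriv f z = z⁻¹ * z⁻¹ * c * f z) : f = 0 := by
  -- The function `exp(c / z)` is an integrating factor, and the punctured plane is connected.
  have hder : ∀ z : ℂ, z ≠ 0 → HasDerivAt (fun z => f z * Complex.exp (c * z⁻¹)) 0 z := by
    intro z hz
    have h1 := (hf z).hasDerivAt.mul (((hasDerivAt_inv hz).const_mul c).cexp)
    refine h1.congr_deriv ?_
    rw [h z hz]
    field_simp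
    ring
  have hpre : IsPreconnected ({0}ᶜ : Set ℂ) :=
    (isConnected_compl_singleton_of_one_lt_rank (by simp) 0).isPreconnected
  obtain ⟨C, hC⟩ := (isOpen_compl_singleton (x := (0 : ℂ))).exists_is_const_of_deriv_eq_zero hpre
    (fun z hz => (hder z hz).differentiableAt.differentiableWithinAt)
    (fun z hz => (hder z hz).deriv)
  -- Along `z = -c / t` with `t → +∞`, the factor `exp(c / z) = exp(-t)` tends to `0` while `f z`
  -- tends to `f 0`.
  have hC0 : C = 0 := by
    have ht : Filter.Tendsto (fun t : ℝ => f (-(c * ((t⁻¹ : ℝ) : ℂ)))) Filter.atTop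
        (𝓝 (f 0)) := by
      refine (hf.continuous.tendsto 0).comp ?_
      have h2 : Filter.Tendsto (fun t : ℝ => ((t⁻¹ : ℝ) : ℂ)) Filter.atTop (𝓝 0) := by
        have := (Complex.continuous_ofReal.tendsto 0).comp tendsto_inv_atTop_zero
        rwa [Complex.ofReal_zero] at this
      simpa using (h2.const_mul c).neg
    have he : Filter.Tendsto (fun t : ℝ => ((Real.exp (-t) : ℝ) : ℂ)) Filter.atTop (𝓝 0) := by
      have := (Complex.continuous_ofReal.tendsto 0).comp
        (Real.tendsto_exp_atBot.comp Filter.tendsto_neg_atTop_atBot)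
      rwa [Complex.ofReal_zero] at this
    have hp := ht.mul he
    rw [mul_zero] at hp
    refine tendsto_nhds_unique (tendsto_const_nhds.congr' ?_) hp
    filter_upwards [Filter.eventually_gt_atTop 0] with t ht0
    have htc : (t : ℂ) ≠ 0 := by exact_mod_cast ht0.ne'
    have hz : -(c * ((t⁻¹ : ℝ) : ℂ)) ≠ 0 := by
      push_cast
      exact neg_ne_zero.2 (mul_ne_zero hc (inv_ne_zero htc))
    rw [← hC _ hz]
    have : c * (-(c * ((t⁻¹ : ℝ) : ℂ)))⁻¹ = ((-t : ℝ) : ℂ) := by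
      push_cast
      field_simp
    simp only [this, Complex.ofReal_exp]
  have hd : Dense ({0}ᶜ : Set ℂ) := dense_compl_singleton 0
  refine hf.continuous.ext_on hd continuous_const fun z hz => ?_
  have := hC z hz
  rw [hC0] at this
  exact (mul_eq_zero.1 this).resolve_right (Complex.exp_ne_zero _)

variable {M : Type*} [TopologicalSpace M] [ChartedSpace E M] [IsManifold 𝓘(ℂ, E) ω M]

theorem isLocallyConstant_of_mvfderiv {f : M → ℂ}
    (hf : ∀ x, MDifferentiableAt 𝓘(ℝ, E) 𝓘(ℝ, ℂ) f x)
    (h : ∀ (x : M) (v : HTan E x), mvfderiv 𝓘(ℝ, E) f x v = 0) : IsLocallyConstant f := by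
  rw [IsLocallyConstant.iff_eventually_eq]
  intro x
  have : IsManifold 𝓘(ℂ, E) 1 M := IsManifold.of_le (n := ω) le_top
  obtain ⟨r, hr, hball⟩ := Metric.isOpen_iff.1 (isOpen_extChartAt_target (I := 𝓘(ℂ, E)) x) _
    (mem_extChartAt_target (I := 𝓘(ℂ, E)) x)
  have hder : ∀ y ∈ (extChartAt 𝓘(ℂ, E) x).target,
      HasFDerivAt (𝕜 := ℝ) (fun y => f ((extChartAt 𝓘(ℂ, E) x).symm y)) 0 y := by
    intro y hy
    have h1 : MDifferentiableAt 𝓘(ℂ, E) 𝓘(ℂ, E) (extChartAt 𝓘(ℂ, E) x).symm y := by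
      have := mdifferentiableWithinAt_extChartAt_symm (I := 𝓘(ℂ, E)) hy
      rwa [modelWithCornersSelf_coe, Set.range_id, mdifferentiableWithinAt_univ] at this
    have h2 := h1.hasMFDerivAt
    have h3 : HasMFDerivAt 𝓘(ℝ, E) 𝓘(ℝ, E) (extChartAt 𝓘(ℂ, E) x).symm y
      ((mfderiv 𝓘(ℂ, E) 𝓘(ℂ, E) (extChartAt 𝓘(ℂ, E) x).symm y : E →L[ℂ] E).restrictScalars ℝ) :=
      ⟨h2.1, h2.2.restrictScalars ℝ⟩
    have h4 : HasMFDerivAt 𝓘(ℝ, E) 𝓘(ℝ, ℂ) f ((extChartAt 𝓘(ℂ, E) x).symm y)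
        (0 : E →L[ℝ] ℂ) := by
      have h5 := (hf ((extChartAt 𝓘(ℂ, E) x).symm y)).hasMFDerivAt
      have h6 : mfderiv 𝓘(ℝ, E) 𝓘(ℝ, ℂ) f ((extChartAt 𝓘(ℂ, E) x).symm y)
          = (0 : E →L[ℝ] ℂ) := by
        ext v
        exact h _ v
      rwa [h6] at h5
    have h7 := (h4.comp y h3).hasFDerivAt
    refine h7.congr_fderiv ?_
    ext v
    rfl
  have hconst : ∀ y ∈ Metric.ball (extChartAt 𝓘(ℂ, E) x x) r,
      f ((extChartAt 𝓘(ℂ, E) x).symm y) = f x := by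
    intro y hy
    have h8 := Metric.isOpen_ball.is_const_of_fderiv_eq_zero
      (convex_ball (extChartAt 𝓘(ℂ, E) x x) r).isPreconnected
      (𝕜 := ℝ) (f := fun y => f ((extChartAt 𝓘(ℂ, E) x).symm y))
      (fun y hy => (hder y (hball hy)).differentiableAt.differentiableWithinAt)
      (fun y hy => (hder y (hball hy)).fderiv) hy (Metric.mem_ball_self hr)
    simpa using h8
  filter_upwards [(continuousAt_extChartAt (I := 𝓘(ℂ, E)) x).preimage_mem_nhds
    (Metric.ball_mem_nhds _ hr), extChartAt_source_mem_nhds (I := 𝓘(ℂ, E)) x] with y hy hy'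
  have h9 := hconst _ hy
  rwa [(extChartAt 𝓘(ℂ, E) x).left_inv hy'] at h9

theorem IsSmoothAtProd.differentiableAt {s : ℂ → ∀ x : M, HTan E x} {z : ℂ} {x : M}
    (h : IsSmoothAtProd s z x) : DifferentiableAt ℝ (fiberCurve s x) z := by
  rw [isSmoothAtProd_iff] at h
  have h1 : ContMDiffAt 𝓘(ℝ, ℂ) 𝓘(ℝ, E) ∞ (fun w => coord x x (s w x)) z :=
    ContMDiffAt.comp (f := fun w : ℂ => (w, x)) z h (contMDiffAt_id.prodMk contMDiffAt_const)
  have h2 := h1.contDiffAt.differentiableAt (by simp)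
  let A : E →L[ℂ] E := ofCoord x x
  have h3 := (A.restrictScalars ℝ).differentiableAt.comp z h2
  refine h3.congr_of_eventuallyEq (Filter.Eventually.of_forall fun w => ?_)
  exact (ofCoord_coord (mem_of_mem_nhds (coordDomain_mem_nhds x)) (s w x)).symm

end Analysis

/-! ### Every potential is a diagonal exponential. -/

section Uniqueness

variable {E : Type*} [NormedAddCommGroup E] [NormedSpace ℂ E] [FiniteDimensional ℂ E]
  {M : Type*} [TopologicalSpace M] [ChartedSpace E M] [IsManifold 𝓘(ℂ, E) ω M]

namespace CDVStructure

variable {S : CDVStructure E M} {m : ℕ} {e : Fin m → ∀ x : M, HTan E x}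
  {φ : ℂ → ∀ x : M, HTan E x ≃ₗ[ℂ] HTan E x}

/-- The matrix entries of a potential, twisted by the factor `exp (-z ū_j)`. -/
def twistedEntry (S : CDVStructure E M) (e : Fin m → ∀ x : M, HTan E x)
    (φ : ℂ → ∀ x : M, HTan E x ≃ₗ[ℂ] HTan E x) (j i : Fin m) (z : ℂ) (x : M) : ℂ :=
  S.coeff e j x (φ z x (e i x)) * Complex.exp (-z * conj (S.eig e j x))

variable (hpos : S.IsPositive) (hDn : S.DPrimeEqNabla)
  (h : S.IsIdempotentFrameOn e Set.univ) (hP : S.IsPotential φ)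

include hpos hDn h hP

/-- Since `𝓥 = 𝓠 = 0`, the entries satisfy `∂_z φ_{ji} = (z⁻²(u_i - u_j) + ū_j) φ_{ji}`; the twist
removes `ū_j`. Holomorphy at `z = 0` comes from `dbar_z`. -/
theorem hasDerivAt_twistedEntry (j i : Fin m) (x : M) :
    Differentiable ℂ (fun z => twistedEntry S e φ j i z x) ∧
    ∀ z ≠ 0, deriv (fun z => twistedEntry S e φ j i z x) z =
      z⁻¹ * z⁻¹ * (S.eig e i x - S.eig e j x) * twistedEntry S e φ j i z x := by
  have hx := Set.mem_univ x
  have hs : ∀ z, IsHolAtProd (fun _ => e i) z x := fun z => (h.hol i x hx).isHolAtProd z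
  have hd : ∀ z, HasDerivAt (F := E) (fiberCurve (fun w y => φ w y (e i y)) x)
      (partialZSec (fun w y => φ w y (e i y)) z x) z := fun z =>
    hasDerivAt_of_partialZBar (E := E) (hP.smooth _ z x (hs z)).differentiableAt
      (hP.dbar_z _ z x (hs z))
  have hexp : ∀ z, HasDerivAt (fun z => Complex.exp (-z * conj (S.eig e j x)))
      (Complex.exp (-z * conj (S.eig e j x)) * (-1 * conj (S.eig e j x))) z := fun z =>
    ((hasDerivAt_neg z).mul_const _).cexp
  have ht : ∀ z, HasDerivAt (fun z => twistedEntry S e φ j i z x) _ z := fun z =>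
    (hasDerivAt_linearMap_comp (E := E) (S.coeff e j x) (hd z)).mul (hexp z)
  refine ⟨fun z => (ht z).differentiableAt, fun z hz => ?_⟩
  rw [(ht z).deriv]
  have hQ := Q_eq_zero_of_frame h hx fun i v => D_frame h hx hpos hDn i v
  have h0 : partialZSec (fun _ => e i) z x = 0 :=
    partialZ_of_hasDerivAt (E := E) (hasDerivAt_const (F := E) z (e i x))
  have h1 := congrArg (S.coeff e j x) (hP.connection_z _ z x (hs z) hz)
  rw [FrobeniusManifold.nablaTildeZ, DTildeZ, V_eq_Q hDn, hQ, h0, h.U_frame hx] at h1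
  simp only [LinearMap.zero_apply, sub_zero, zero_add, map_add, map_sub, map_smul,
    h.coeff_U hx, coeff_UDagger h hx hpos hDn, smul_eq_mul] at h1
  have h2 : S.coeff e j x (partialZSec (fun w y => φ w y (e i y)) z x) =
      (z⁻¹ * z⁻¹ * (S.eig e i x - S.eig e j x) + conj (S.eig e j x)) *
        S.coeff e j x (φ z x (e i x)) := by
    have hzz : z⁻¹ * z = 1 := inv_mul_cancel₀ hz
    linear_combination -h1 + conj (S.eig e j x) * S.coeff e j x (φ z x (e i x)) * hzz
  change S.coeff e j x (partialZSec (fun w y => φ w y (e i y)) z x) * _ +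
    S.coeff e j x (φ z x (e i x)) * _ = _
  rw [h2, twistedEntry]
  ring

theorem coeff_potential_of_ne (hss : S.IsSemisimple) {j i : Fin m} (hij : j ≠ i) (z : ℂ) (x : M) :
    S.coeff e j x (φ z x (e i x)) = 0 := by
  obtain ⟨h1, h2⟩ := hasDerivAt_twistedEntry hpos hDn h hP j i x
  have h3 := entire_eq_zero_of_irregular h1 (sub_ne_zero.2 fun hij' =>
    hij (h.eig_injective (Set.mem_univ x) hss hij').symm) h2
  exact (mul_eq_zero.1 (congrFun h3 z)).resolve_right (Complex.exp_ne_zero _)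

theorem potential_frame (hss : S.IsSemisimple) (i : Fin m) (z : ℂ) (x : M) :
    φ z x (e i x) = S.coeff e i x (φ z x (e i x)) • e i x :=
  h.eq_smul_of_coeff (Set.mem_univ x) fun _ hij =>
    coeff_potential_of_ne hpos hDn h hP hss hij z x

/-- Along `M` the `Φ` terms on the two sides of the connection equation cancel, so `∂ φ_{ii} = 0`.
The holomorphic structure of `𝓗₂` gives `∂̄ φ_{ii} = z · conj(du_i) · φ_{ii}`, which the twist
compensates. -/
theorem mvfderiv_twistedEntry (hss : S.IsSemisimple) (i : Fin m) {z : ℂ} (hz : z ≠ 0) (x : M) :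
    MDifferentiableAt 𝓘(ℝ, E) 𝓘(ℝ, ℂ) (twistedEntry S e φ i i z) x ∧
    ∀ v : HTan E x, mvfderiv 𝓘(ℝ, E) (twistedEntry S e φ i i z) x v = 0 := by
  have hx := Set.mem_univ x
  have hs : IsHolAtProd (fun _ => e i) z x := (h.hol i x hx).isHolAtProd z
  have he := (h.hol i x hx).isSmoothAt
  have ha : ContMDiffAt 𝓘(ℝ, E) 𝓘(ℝ, ℂ) ∞ (fun y => S.coeff e i y (φ z y (e i y))) x :=
    ContMDiffAt.comp (f := fun y : M => (z, y)) x
      (h.coeff_smooth_prod hx i (hP.smooth _ z x hs)) (contMDiffAt_const.prodMk contMDiffAt_id)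
  have hexp := contMDiffAt_exp_conj (h.eig_hol hx i) (-z)
  have hf : ContMDiffAt 𝓘(ℝ, E) 𝓘(ℝ, ℂ) ∞ (twistedEntry S e φ i i z) x :=
    ContMDiffAt.complex_smul (E := ℂ) ha hexp
  refine ⟨hf.mdifferentiableAt (by simp), fun v => ?_⟩
  have hfun : (fun y => φ z y (e i y)) = fun y => S.coeff e i y (φ z y (e i y)) • e i y :=
    funext fun y => potential_frame hpos hDn h hP hss i z y
  have hdel : delFun (fun y => S.coeff e i y (φ z y (e i y))) x v = 0 := by
    have h1 := congrArg (S.coeff e i x) (hP.connection _ z x hs hz v)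
    have h0 : (0 : HTan E x →L[ℂ] HTan E x) v = 0 := rfl
    rw [FrobeniusManifold.nablaTilde, DTilde, nabla_frame h hx hpos hDn, h0, zero_add,
      h.higgs_frame hx, hfun, S.dPrime_smul ha he, ← S.D_eq_dPrime (h.hol i x hx),
      D_frame h hx hpos hDn] at h1
    simp only [map_smul, map_neg, map_add, h.coeff_higgs hx, h.coeff_self hx, smul_zero, zero_add,
      smul_eq_mul, mul_one] at h1
    linear_combination -h1
  have hdelBar : delBarFun (fun y => S.coeff e i y (φ z y (e i y))) x v =
      z * conj (S.coeff e i x v) * S.coeff e i x (φ z x (e i x)) := by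
    have h1 := congrArg (S.coeff e i x) (hP.dbar _ z x hs v)
    rw [dbarTilde, hfun, S.dSecond_smul ha he, S.D_dbar x _ (h.hol i x hx)] at h1
    simp only [map_smul, map_add, coeff_higgsDagger h hx hpos hDn, h.coeff_self hx, smul_zero,
      zero_add, smul_eq_mul, mul_one, map_zero] at h1
    linear_combination h1
  have hsplit : mvfderiv 𝓘(ℝ, E) (twistedEntry S e φ i i z) x v =
      delFun (twistedEntry S e φ i i z) x v + delBarFun (twistedEntry S e φ i i z) x v := by
    simp only [delFun, delBarFun]
    ring
  have h5 : delFun (twistedEntry S e φ i i z) x v = 0 := by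
    refine (delFun_mul ha hexp v).trans ?_
    rw [hdel, delFun_exp_conj (h.eig_hol hx i)]
    ring
  have h6 : delBarFun (twistedEntry S e φ i i z) x v = 0 := by
    refine (delBarFun_mul ha hexp v).trans ?_
    rw [hdelBar, delBarFun_exp_conj (h.eig_hol hx i),
      mvfderiv_eig h hx fun i v => D_frame h hx hpos hDn i v]
    ring
  rw [hsplit, h5, h6, add_zero]

theorem exists_potential_constants [PreconnectedSpace M] [Nonempty M] (hss : S.IsSemisimple) :
    ∃ k : Fin m → ℂ, (∀ i, k i ≠ 0) ∧ ∀ (z : ℂ) (x : M) (i : Fin m),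
      φ z x (e i x) = (k i * Complex.exp (z * conj (S.eig e i x))) • e i x := by
  obtain ⟨x₀⟩ := ‹Nonempty M›
  have hk : ∀ (z : ℂ) (x : M) (i : Fin m),
      twistedEntry S e φ i i z x = twistedEntry S e φ i i 1 x₀ := by
    intro z x i
    obtain ⟨h1, h2⟩ := hasDerivAt_twistedEntry hpos hDn h hP i i x
    -- The connection equation along `M` needs `z ≠ 0`, so every `z`, including `0`, is first moved
    -- to `1`.
    rw [entire_const_of_deriv h1 (fun z hz => by rw [h2 z hz]; ring) z 1]
    have h3 := fun x => mvfderiv_twistedEntry hpos hDn h hP hss i one_ne_zero x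
    exact (isLocallyConstant_of_mvfderiv (fun x => (h3 x).1)
      fun x => (h3 x).2).apply_eq_of_preconnectedSpace x x₀
  have hform : ∀ (z : ℂ) (x : M) (i : Fin m), φ z x (e i x) =
      (twistedEntry S e φ i i 1 x₀ * Complex.exp (z * conj (S.eig e i x))) • e i x := by
    intro z x i
    rw [← hk z x i, twistedEntry, mul_assoc, ← Complex.exp_add, neg_mul, neg_add_cancel,
      Complex.exp_zero, mul_one]
    exact potential_frame hpos hDn h hP hss i z x
  refine ⟨fun i => twistedEntry S e φ i i 1 x₀, fun i hi => ?_, hform⟩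
  have h4 := hform 1 x₀ i
  rw [show twistedEntry S e φ i i 1 x₀ = 0 from hi, zero_mul, zero_smul] at h4
  exact h.ne_zero x₀ (Set.mem_univ _) i ((LinearEquiv.map_eq_zero_iff _).1 h4)

end CDVStructure
end Uniqueness

/-! ### Local idempotent frames and canonical coordinates. -/

section LocalFrames

variable {E : Type*} [NormedAddCommGroup E] [NormedSpace ℂ E]
  {M : Type*} [TopologicalSpace M] [ChartedSpace E M] [IsManifold 𝓘(ℂ, E) ω M]

theorem IsHolAt.eventually {X : ∀ x : M, HTan E x} {x : M} (h : IsHolAt X x) :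
    ∀ᶠ y in 𝓝 x, IsHolAt X y := by
  have := (contMDiffAt_iff_contMDiffAt_nhds (n := ω) (by simp)).1 h
  exact this

namespace FrobeniusManifold

section

variable {F : FrobeniusManifold E M}

theorem CanonicalCoordinates.U_frame {m : ℕ} (c : F.CanonicalCoordinates m) (i : Fin m) (x : M) :
    F.U x (c.frame i x) = c.u x i • c.frame i x := by
  rw [U, c.euler_eq, map_sum, LinearMap.sum_apply, Finset.sum_eq_single i]
  · rw [LinearMap.map_smul₂, c.frame_mul, if_pos rfl]
  · intro j _ hj
    rw [LinearMap.map_smul₂, c.frame_mul, if_neg hj, smul_zero]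
  · simp

theorem CanonicalCoordinates.frame_ne_zero {m : ℕ} (c : F.CanonicalCoordinates m) (i : Fin m)
    (x : M) : c.frame i x ≠ 0 := by
  intro h
  have h1 := c.frame_dual i x
  rw [h, map_zero] at h1
  have h2 := congrFun h1 i
  simp at h2

end

variable (F : FrobeniusManifold E M)

/-- The multiplication in the coordinates given by the trivialization at `x`. -/
def mulCoord (x y : M) : E →ₗ[ℂ] E →ₗ[ℂ] E :=
  LinearMap.mk₂ ℂ (fun p q => coord x y (F.mul y (ofCoord x y p) (ofCoord x y q)))
    (fun _ _ _ => by simp only [map_add, LinearMap.add_apply])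
    (fun _ _ _ => by simp only [map_smul, LinearMap.smul_apply])
    (fun _ _ _ => by simp only [map_add])
    (fun _ _ _ => by simp only [map_smul])

theorem mulCoord_apply (x y : M) (p q : E) :
    F.mulCoord x y p q = coord x y (F.mul y (ofCoord x y p) (ofCoord x y q)) := rfl

theorem mulCoord_coord {x y : M} (hy : y ∈ coordDomain E x) (v w : HTan E y) :
    F.mulCoord x y (coord x y v) (coord x y w) = coord x y (F.mul y v w) := by
  rw [mulCoord_apply, ofCoord_coord hy, ofCoord_coord hy]

/-- The equation of idempotents in a chart and a trivialization. -/
def idempotentEq (x : M) (v : E × E) : E :=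
  F.mulCoord x ((extChartAt 𝓘(ℂ, E) x).symm v.1) v.2 v.2 - v.2

variable [FiniteDimensional ℂ E]

/-- Bilinearity reduces joint analyticity to the products of constant-coordinate fields, which
depend on the base point alone. -/
theorem contDiffAt_idempotentEq (x : M) (p : E) :
    ContDiffAt ℂ ω (F.idempotentEq x) (extChartAt 𝓘(ℂ, E) x x, p) := by
  let b := Module.finBasis ℂ E
  have hexp : F.idempotentEq x = fun v => (∑ k, ∑ l, (b.repr v.2 k * b.repr v.2 l) •
      F.mulCoord x ((extChartAt 𝓘(ℂ, E) x).symm v.1) (b k) (b l)) - v.2 := by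
    funext v
    rw [idempotentEq]
    congr 1
    conv_lhs => rw [← b.sum_repr v.2]
    simp only [map_sum, LinearMap.sum_apply, map_smul, LinearMap.smul_apply, smul_smul,
      Finset.smul_sum]
    rw [Finset.sum_comm]
    refine Finset.sum_congr rfl fun k _ => Finset.sum_congr rfl fun l _ => ?_
    rw [_root_.mul_comm]
  have hrepr : ∀ k, ContDiff ℂ ω (fun v : E × E => b.repr v.2 k) := fun k =>
    (LinearMap.toContinuousLinearMap (b.coord k)).contDiff.comp contDiff_snd
  rw [hexp]
  refine ContDiffAt.sub (ContDiffAt.sum fun k _ => ContDiffAt.sum fun l _ => ?_)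
    contDiffAt_snd
  refine ContDiffAt.smul ((hrepr k).mul (hrepr l)).contDiffAt ?_
  have h1 : ContMDiffAt 𝓘(ℂ, E) 𝓘(ℂ, E) ω (fun y => F.mulCoord x y (b k) (b l)) x :=
    isHolAt_iff.1 (F.mul_holomorphic x _ _ (isHolAt_ofCoord x (b k)) (isHolAt_ofCoord x (b l)))
  have h2 := (contMDiffAt_iff.1 h1).2
  rw [modelWithCornersSelf_coe, Set.range_id, contDiffWithinAt_univ] at h2
  exact ContDiffAt.comp (g := fun t : E =>
    F.mulCoord x ((extChartAt 𝓘(ℂ, E) x).symm t) (b k) (b l)) (f := Prod.fst)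
    (extChartAt 𝓘(ℂ, E) x x, p) h2 contDiffAt_fst

/-- Along the line `p + s q` the equation is quadratic in `s`, with linear coefficient `2 p ∘ q -
q`. -/
theorem fderiv_idempotentEq (x : M) (p q : E) :
    fderiv ℂ (F.idempotentEq x) (extChartAt 𝓘(ℂ, E) x x, p) (0, q) =
      (2 : ℂ) • F.mulCoord x x p q - q := by
  have h1 := ((F.contDiffAt_idempotentEq x p).differentiableAt (by simp)).hasFDerivAt
  have h2 : HasDerivAt (fun s : ℂ => ((extChartAt 𝓘(ℂ, E) x x, p + s • q) : E × E)) (0, q) 0 := by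
    refine HasDerivAt.prodMk (hasDerivAt_const _ _) ?_
    simpa using ((hasDerivAt_id (0 : ℂ)).smul_const q).const_add p
  have h3 := HasFDerivAt.comp_hasDerivAt_of_eq (0 : ℂ) h1 h2 (by simp)
  have hcomm : F.mulCoord x x q p = F.mulCoord x x p q := by
    rw [mulCoord_apply, mulCoord_apply, F.mul_comm]
  have h4 : (F.idempotentEq x ∘ fun s : ℂ => ((extChartAt 𝓘(ℂ, E) x x, p + s • q) : E × E)) =
      fun s : ℂ => (F.mulCoord x x p p - p) + (s • ((2 : ℂ) • F.mulCoord x x p q - q) +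
        (s * s) • F.mulCoord x x q q) := by
    funext s
    simp only [Function.comp_apply, idempotentEq, extChartAt_to_inv, map_add, map_smul,
      LinearMap.add_apply, LinearMap.smul_apply, hcomm]
    module
  rw [h4] at h3
  have h5 : HasDerivAt (fun s : ℂ => (F.mulCoord x x p p - p) +
      (s • ((2 : ℂ) • F.mulCoord x x p q - q) + (s * s) • F.mulCoord x x q q))
      ((1 : ℂ) • ((2 : ℂ) • F.mulCoord x x p q - q)
        + ((1 : ℂ) * 0 + 0 * 1) • F.mulCoord x x q q) 0 :=
    HasDerivAt.const_add _ (((hasDerivAt_id (0 : ℂ)).smul_const _).add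
      (((hasDerivAt_id (0 : ℂ)).mul (hasDerivAt_id (0 : ℂ))).smul_const _))
  have h6 := h3.unique h5
  simpa using h6

/-- For idempotent `p`, the map `q ↦ 2 p ∘ q - q` is an involution, so the implicit function theorem
applies. -/
theorem isInvertible_fderiv_idempotentEq (x : M) {p : E} (hp : F.mulCoord x x p p = p) :
    (fderiv ℂ (F.idempotentEq x) (extChartAt 𝓘(ℂ, E) x x, p) ∘L
      .inr ℂ E E).IsInvertible := by
  set A : E →L[ℂ] E := fderiv ℂ (F.idempotentEq x) (extChartAt 𝓘(ℂ, E) x x, p) ∘L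
      .inr ℂ E E
  have hA : ∀ q, A q = (2 : ℂ) • F.mulCoord x x p q - q := fun q => F.fderiv_idempotentEq x p q
  have hxx := mem_of_mem_nhds (coordDomain_mem_nhds (E := E) x)
  have hassoc : ∀ q, F.mulCoord x x p (F.mulCoord x x p q) = F.mulCoord x x p q := by
    intro q
    conv_rhs => rw [← hp]
    simp only [mulCoord_apply, ofCoord_coord hxx, F.mul_assoc]
  have hAA : ∀ q, A (A q) = q := by
    intro q
    simp only [hA, map_sub, map_smul, hassoc]
    module
  exact ⟨ContinuousLinearEquiv.equivOfInverse A A hAA hAA, rfl⟩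

/-- Idempotents extend uniquely to local holomorphic fields of idempotents. -/
theorem exists_idempotent_section (x : M) {p : HTan E x} (hp : F.mul x p p = p) :
    ∃ X : ∀ x : M, HTan E x, IsHolAt X x ∧ X x = p ∧ (∀ᶠ y in 𝓝 x, F.mul y (X y) (X y) = X y) ∧
      ∀ Y : ∀ x : M, HTan E x, IsHolAt Y x → Y x = p →
        (∀ᶠ y in 𝓝 x, F.mul y (Y y) (Y y) = Y y) → ∀ᶠ y in 𝓝 x, Y y = X y := by
  have hxx := mem_of_mem_nhds (coordDomain_mem_nhds (E := E) x)
  have hp' : F.mulCoord x x (coord x x p) (coord x x p) = coord x x p := by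
    rw [F.mulCoord_coord hxx, hp]
  have hf := F.contDiffAt_idempotentEq x (coord x x p)
  have hinv := F.isInvertible_fderiv_idempotentEq x hp'
  have hf0 : F.idempotentEq x (extChartAt 𝓘(ℂ, E) x x, coord x x p) = 0 := by
    rw [idempotentEq, extChartAt_to_inv, hp', sub_self]
  have hω : (ω : WithTop ℕ∞) ≠ 0 := by simp
  let ψ := hf.implicitFunction hω hinv
  have hψ : ContDiffAt ℂ ω ψ (extChartAt 𝓘(ℂ, E) x x) := hf.contDiffAt_implicitFunction hω hinv
  have hψ0 : ψ (extChartAt 𝓘(ℂ, E) x x) = coord x x p := hf.implicitFunction_apply_self hω hinv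
  have hψ1 : ∀ᶠ t in 𝓝 (extChartAt 𝓘(ℂ, E) x x), F.idempotentEq x (t, ψ t) = 0 := by
    rw [← hf0]
    exact hf.eventually_apply_implicitFunction hω hinv
  -- This equivalence carries the uniqueness of the extension.
  have hψ2 : ∀ᶠ v in 𝓝 (extChartAt 𝓘(ℂ, E) x x, coord x x p),
      F.idempotentEq x v = 0 ↔ ψ v.1 = v.2 := by
    rw [← hf0]
    exact hf.eventually_apply_eq_iff_implicitFunction hω hinv
  have hchart := continuousAt_extChartAt (I := 𝓘(ℂ, E)) x
  have hsrc := extChartAt_source_mem_nhds (I := 𝓘(ℂ, E)) x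
  refine ⟨fun y => ofCoord x y (ψ (extChartAt 𝓘(ℂ, E) x y)), ?_, ?_, ?_, ?_⟩
  · rw [isHolAt_iff]
    have h1 : ContMDiffAt 𝓘(ℂ, E) 𝓘(ℂ, E) ω (fun y => ψ (extChartAt 𝓘(ℂ, E) x y)) x :=
      hψ.contMDiffAt.comp x contMDiffAt_extChartAt
    refine h1.congr_of_eventuallyEq ?_
    filter_upwards [coordDomain_mem_nhds (E := E) x] with y hy using coord_ofCoord hy _
  · simp only [hψ0]
    exact ofCoord_coord hxx p
  · filter_upwards [hchart.eventually hψ1, hsrc, coordDomain_mem_nhds (E := E) x]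
      with y hy hys hyd
    rw [idempotentEq, (extChartAt 𝓘(ℂ, E) x).left_inv hys, sub_eq_zero, mulCoord_apply] at hy
    have h2 := congrArg (ofCoord x y) hy
    rwa [ofCoord_coord hyd] at h2
  · intro Y hY hYp hYi
    have hc : ContinuousAt (fun y => (extChartAt 𝓘(ℂ, E) x y, coord x y (Y y))) x :=
      hchart.prodMk (isHolAt_iff.1 hY).continuousAt
    have hc' : Filter.Tendsto (fun y => (extChartAt 𝓘(ℂ, E) x y, coord x y (Y y))) (𝓝 x)
        (𝓝 (extChartAt 𝓘(ℂ, E) x x, coord x x p)) := by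
      have := hc.tendsto
      rwa [hYp] at this
    filter_upwards [hc'.eventually hψ2, hYi, hsrc, coordDomain_mem_nhds (E := E) x]
      with y hy hyi hys hyd
    have h3 : F.idempotentEq x (extChartAt 𝓘(ℂ, E) x y, coord x y (Y y)) = 0 := by
      simp only [idempotentEq]
      rw [(extChartAt 𝓘(ℂ, E) x).left_inv hys, F.mulCoord_coord hyd, hyi, sub_self]
    rw [hy.1 h3, ofCoord_coord hyd]

theorem eventually_eq_zero_of_idempotent {x : M} {X : ∀ x : M, HTan E x} (hX : IsHolAt X x)
    (hX0 : X x = 0) (hXi : ∀ᶠ y in 𝓝 x, F.mul y (X y) (X y) = X y) : ∀ᶠ y in 𝓝 x, X y = 0 := by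
  obtain ⟨Z, -, -, -, hZ⟩ := F.exists_idempotent_section x (p := 0) (by simp)
  filter_upwards [hZ X hX hX0 hXi, hZ (fun _ => 0) (isHolAt_zero x) rfl (by simp)] with y h1 h2
  rw [h1, ← h2]

/-- Products of eigenvectors of `𝓤` for distinct eigenvalues lie in two eigenspaces, hence vanish.
Writing the unit as `∑ a_i v_i` gives `a_i v_i ∘ v_i = v_i`, so the `a_i v_i` are the idempotents.
-/
theorem exists_idempotents (hss : F.IsSemisimple) (x : M) :
    ∃ p : Fin (Module.finrank ℂ E) → HTan E x, (∀ i, p i ≠ 0) ∧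
      ∀ i j, F.mul x (p i) (p j) = if i = j then p i else 0 := by
  obtain ⟨μ, hμ, heig⟩ := hss x
  choose v hv using fun k => (heig k).exists_hasEigenvector
  have hU : ∀ k, F.mul x (F.euler x) (v k) = μ k • v k := fun k => (hv k).apply_eq_smul
  have hli : LinearIndependent ℂ (M := E) v :=
    Module.End.eigenvectors_linearIndependent' (F.U x : Module.End ℂ (HTan E x)) μ hμ v hv
  obtain ⟨a, ha⟩ := exists_sum_of_linearIndependent hli rfl (F.unit x)
  have ha' : F.unit x = ∑ i, a i • v i := ha
  have horth : ∀ i j, i ≠ j → F.mul x (v i) (v j) = 0 := by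
    intro i j hij
    have h1 : F.mul x (F.euler x) (F.mul x (v i) (v j)) = μ i • F.mul x (v i) (v j) := by
      rw [← F.mul_assoc, hU, LinearMap.map_smul₂]
    have h2 : F.mul x (F.euler x) (F.mul x (v i) (v j)) = μ j • F.mul x (v i) (v j) := by
      rw [F.mul_comm x (v i), ← F.mul_assoc, hU, LinearMap.map_smul₂]
    have h3 : (μ i - μ j) • F.mul x (v i) (v j) = 0 := by rw [sub_smul, ← h1, ← h2, sub_self]
    exact (smul_eq_zero.1 h3).resolve_left (sub_ne_zero.2 fun h => hij (hμ h))
  have hself : ∀ j, a j • F.mul x (v j) (v j) = v j := by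
    intro j
    have h1 := F.unit_mul x (v j)
    rw [ha', map_sum, LinearMap.sum_apply, Finset.sum_eq_single j] at h1
    · rwa [LinearMap.map_smul₂] at h1
    · intro i _ hij
      rw [LinearMap.map_smul₂, horth i j hij, smul_zero]
    · simp
  have hane : ∀ j, a j ≠ 0 := by
    intro j hj
    have h1 := hself j
    rw [hj, zero_smul] at h1
    exact (hv j).2 h1.symm
  refine ⟨fun i => a i • v i, fun i => smul_ne_zero (hane i) (hv i).2, fun i j => ?_⟩
  split_ifs with hij
  · subst hij
    rw [LinearMap.map_smul₂, map_smul, hself]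
  · rw [LinearMap.map_smul₂, map_smul, horth i j hij, smul_zero, smul_zero]

theorem exists_idempotentFrame (hss : F.IsSemisimple) (x : M) :
    ∃ (m : ℕ) (e : Fin m → ∀ x : M, HTan E x) (O : Set M),
      F.IsIdempotentFrameOn e O ∧ x ∈ O := by
  obtain ⟨p, hp0, hp⟩ := F.exists_idempotents hss x
  choose X hXh hXp hXi _ using fun i => F.exists_idempotent_section x (p := p i) (by simp [hp])
  have hne : ∀ i, ∀ᶠ y in 𝓝 x, X i y ≠ 0 := by
    intro i
    have hc := (isHolAt_iff.1 (hXh i)).continuousAt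
    have hxx := mem_of_mem_nhds (coordDomain_mem_nhds (E := E) x)
    have h0 : coord x x (X i x) ≠ 0 := by
      intro h0
      have := ofCoord_coord hxx (X i x)
      rw [h0, map_zero, hXp] at this
      exact hp0 i this.symm
    filter_upwards [hc.eventually_ne h0] with y hy h
    rw [h, map_zero] at hy
    exact hy rfl
  have horth : ∀ i j, ∀ᶠ y in 𝓝 x, F.mul y (X i y) (X j y) = if i = j then X i y else 0 := by
    intro i j
    split_ifs with hij
    · subst hij
      exact hXi i
    -- The product of two idempotent fields is an idempotent field; vanishing at `x`, it vanishes
    -- nearby by uniqueness.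
    · refine F.eventually_eq_zero_of_idempotent (F.mul_holomorphic x _ _ (hXh i) (hXh j)) ?_ ?_
      · rw [hXp, hXp, hp, if_neg hij]
      · filter_upwards [hXi i, hXi j] with y hi hj
        rw [F.mul_assoc, ← F.mul_assoc y (X j y), F.mul_comm y (X j y) (X i y),
          F.mul_assoc y (X i y), hj, ← F.mul_assoc, hi]
  have hall : ∀ᶠ y in 𝓝 x, (∀ i, IsHolAt (X i) y) ∧ (∀ i, X i y ≠ 0) ∧
      ∀ i j, F.mul y (X i y) (X j y) = if i = j then X i y else 0 := by
    refine (Filter.eventually_all.2 fun i => (hXh i).eventually).and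
      ((Filter.eventually_all.2 hne).and
        (Filter.eventually_all.2 fun i => Filter.eventually_all.2 (horth i)))
  obtain ⟨O, hO, hOo, hxO⟩ := eventually_nhds_iff.1 hall
  exact ⟨_, X, O, ⟨hOo, fun i y hy => (hO y hy).1 i, fun y hy => (hO y hy).2.2,
    fun y hy => (hO y hy).2.1, rfl⟩, hxO⟩

variable {F}

/-- The field `∂/∂u^i` is an eigenvector of `𝓤` for the continuous eigenvalue `u^i`. Near `x` this
can meet only one `eig`, so the field is a multiple of a single `e_{j₀}`; two nonzero idempotents on
one line coincide. -/
theorem CanonicalCoordinates.frame_hol {m : ℕ} (c : F.CanonicalCoordinates m)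
    (hss : F.IsSemisimple) (i : Fin m) (x : M) : IsHolAt (c.frame i) x := by
  obtain ⟨n, e, O, h, hx⟩ := F.exists_idempotentFrame hss x
  have hcoef : ∀ y ∈ O, ∀ j, (F.eig e j y - c.u y i) * F.coeff e j y (c.frame i y) = 0 := by
    intro y hy j
    have h1 := congrArg (F.coeff e j y) (c.U_frame i y)
    rw [h.coeff_U hy, map_smul, smul_eq_mul] at h1
    rw [sub_mul, h1, sub_self]
  obtain ⟨j₀, hj₀⟩ : ∃ j, F.coeff e j x (c.frame i x) ≠ 0 := by
    by_contra! hall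
    exact c.frame_ne_zero i x (h.ext_coeff hx fun j => by rw [hall, map_zero])
  have hj₀' : F.eig e j₀ x = c.u x i :=
    sub_eq_zero.1 ((mul_eq_zero.1 (hcoef x hx j₀)).resolve_right hj₀)
  have hu : ContinuousAt (fun y => c.u y i) x :=
    (continuous_apply i).continuousAt.comp (c.u_holomorphic x).continuousAt
  have hev : ∀ᶠ y in 𝓝 x, ∀ j, j ≠ j₀ → F.eig e j y - c.u y i ≠ 0 := by
    refine Filter.eventually_all.2 fun j => ?_
    by_cases hj : j = j₀
    · exact Filter.Eventually.of_forall fun y hy => absurd hj hy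
    · have hne : F.eig e j x - c.u x i ≠ 0 := by
        rw [← hj₀']
        exact sub_ne_zero.2 fun h' => hj (h.eig_injective hx hss h')
      filter_upwards [((h.eig_hol hx j).continuousAt.sub hu).eventually_ne hne] with y hy _
      exact hy
  refine (h.hol j₀ x hx).congr ?_
  filter_upwards [hev, h.mem_nhds hx] with y hy hyO
  have h2 := h.eq_smul_of_coeff hyO (i := j₀) fun j hj =>
    (mul_eq_zero.1 (hcoef y hyO j)).resolve_left (hy j hj)
  set a := F.coeff e j₀ y (c.frame i y)
  have h3 := c.frame_mul i i y
  rw [if_pos rfl, h2, LinearMap.map_smul₂, map_smul, h.mul_self hyO, smul_smul] at h3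
  have h4 := smul_left_injective ℂ (h.ne_zero y hyO j₀) h3
  have ha : a ≠ 0 := by
    intro ha
    rw [ha, zero_smul] at h2
    exact c.frame_ne_zero i y h2
  rw [h2, mul_left_cancel₀ ha (h4.trans (mul_one a).symm), one_smul]

theorem CanonicalCoordinates.isIdempotentFrameOn [Nonempty M] {m : ℕ}
    (c : F.CanonicalCoordinates m) (hss : F.IsSemisimple) :
    F.IsIdempotentFrameOn c.frame Set.univ where
  isOpen := isOpen_univ
  hol i x _ := c.frame_hol hss i x
  mul x _ i j := c.frame_mul i j x
  ne_zero x _ i := c.frame_ne_zero i x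
  card := by
    obtain ⟨x⟩ := ‹Nonempty M›
    let A : E →ₗ[ℂ] Fin m → ℂ := (mvfderiv 𝓘(ℂ, E) c.u x).toLinearMap
    have := (LinearEquiv.ofBijective A (c.u_etale x)).finrank_eq
    simpa using this.symm

theorem CanonicalCoordinates.eig_eq [Nonempty M] {m : ℕ}
    (c : F.CanonicalCoordinates m) (hss : F.IsSemisimple) (i : Fin m) (x : M) :
    F.eig c.frame i x = c.u x i := by
  rw [eig, c.euler_eq, (c.isIdempotentFrameOn hss).coeff_sum (Set.mem_univ x)]

end FrobeniusManifold

/-! ### Existence of the potential, and the converse in (2). -/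

namespace CDVStructure

variable [FiniteDimensional ℂ E] {S : CDVStructure E M}

theorem isTate_of_dPrimeEqNabla (hpos : S.IsPositive) (hss : S.IsSemisimple)
    (hDn : S.DPrimeEqNabla) : S.IsTate := by
  intro x
  obtain ⟨m, e, O, h, hx⟩ := S.exists_idempotentFrame hss x
  exact Q_eq_zero_of_frame h hx fun i v => D_frame h hx hpos hDn i v

/-- The diagonal endomorphism `exp (z 𝓤†)` in an idempotent frame. -/
def diagExp (S : CDVStructure E M) {m : ℕ} (e : Fin m → ∀ x : M, HTan E x) (z : ℂ) (x : M) :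
    HTan E x →ₗ[ℂ] HTan E x :=
  ∑ i, Complex.exp (z * conj (S.eig e i x)) • (S.coeff e i x).smulRight (e i x)

theorem diagExp_frame {m : ℕ} {e : Fin m → ∀ x : M, HTan E x} {O : Set M}
    (h : S.IsIdempotentFrameOn e O) {x : M} (hx : x ∈ O) (z : ℂ) (i : Fin m) :
    diagExp S e z x (e i x) = Complex.exp (z * conj (S.eig e i x)) • e i x := by
  rw [diagExp, LinearMap.sum_apply, Finset.sum_eq_single i]
  · simp [h.coeff_self hx]
  · intro j _ hj
    simp [h.coeff_of_ne hx hj]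
  · simp

theorem diagExp_diagExp {m : ℕ} {e : Fin m → ∀ x : M, HTan E x} {O : Set M}
    (h : S.IsIdempotentFrameOn e O) {x : M} (hx : x ∈ O) {z w : ℂ} (hzw : z + w = 0)
    (v : HTan E x) : diagExp S e z x (diagExp S e w x v) = v := by
  rw [← h.sum_coeff hx v]
  simp only [map_sum, map_smul, diagExp_frame h hx, smul_smul, mul_assoc, ← Complex.exp_add,
    ← add_mul, add_comm w z, hzw, zero_mul, Complex.exp_zero, mul_one]

/-- Characterizing the map by its action on eigenvectors of `𝓤` frees it from the frame, so
pointwise choices agree with the diagonal formula in every local frame. -/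
theorem exists_exp_UDagger (hss : S.IsSemisimple) (z : ℂ) (x : M) :
    ∃ A : HTan E x ≃ₗ[ℂ] HTan E x, ∀ (v : HTan E x) (c : ℂ), S.U x v = c • v →
      A v = Complex.exp (z * conj c) • v := by
  obtain ⟨m, e, O, h, hx⟩ := S.exists_idempotentFrame hss x
  refine ⟨LinearEquiv.ofLinearMap (diagExp S e z x) (diagExp S e (-z) x)
    (LinearMap.ext fun v => diagExp_diagExp h hx (by ring) v)
    (LinearMap.ext fun v => diagExp_diagExp h hx (by ring) v), fun v c hv => ?_⟩
  refine h.ext_coeff hx fun j => ?_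
  rw [LinearEquiv.coe_ofLinearMap, coeff_eq_of_frame h hx (fun i => diagExp_frame h hx z i),
    map_smul, smul_eq_mul]
  have h1 := congrArg (S.coeff e j x) hv
  rw [h.coeff_U hx, map_smul, smul_eq_mul] at h1
  rcases eq_or_ne (S.coeff e j x v) 0 with h0 | h0
  · rw [h0, mul_zero, mul_zero]
  · rw [mul_right_cancel₀ h0 h1]

theorem isStronglyPotential_of_dPrimeEqNabla (hpos : S.IsPositive) (hss : S.IsSemisimple)
    (hDn : S.DPrimeEqNabla) : S.IsStronglyPotential := by
  choose φ hφ using fun z x => exists_exp_UDagger (S := S) hss z x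
  refine ⟨φ, isPotential_of_frames hpos hDn fun x => ?_⟩
  obtain ⟨m, e, O, h, hx⟩ := S.exists_idempotentFrame hss x
  refine ⟨m, e, O, fun _ => 1, h, hx, fun z y hy i => ?_⟩
  rw [hφ z y _ _ (h.U_frame hy i), one_mul]

/-- Both `D'` and `∇` annihilate the frame, so on a holomorphic section each just differentiates the
coefficients. -/
theorem dPrimeEqNabla_of_flat {m : ℕ} {e : Fin m → ∀ x : M, HTan E x}
    (h : S.IsIdempotentFrameOn e Set.univ) (hss : S.IsSemisimple) (hT : S.IsTate)
    (hflat : ∀ x i, S.nabla (e i) x = 0) : S.DPrimeEqNabla := by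
  intro x σ hσ v
  have hx := Set.mem_univ x
  have hcol := fun i => h.coeff_hol hx i hσ
  have hco := fun i => contMDiffAt_real_of_complex (hcol i)
  have hsm : ∀ i ∈ Finset.univ, IsSmoothAt (fun y => S.coeff e i y (σ y) • e i y) x :=
    fun i _ => IsSmoothAt.smul (hco i) (h.hol i x hx).isSmoothAt
  refine h.ext_coeff hx fun j => ?_
  rw [mvfderiv_coeff_of_flat h hx (fun y _ => hflat y) hσ,
    S.dPrime_congr hσ.isSmoothAt (τ := fun y => ∑ i, S.coeff e i y (σ y) • e i y)
      (Filter.Eventually.of_forall fun y => (h.sum_coeff (Set.mem_univ y) _).symm),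
    S.dPrime_sum Finset.univ hsm]
  have h1 : ∀ i, dPrime S.D (fun y => S.coeff e i y (σ y) • e i y) x v =
      (mvfderiv 𝓘(ℂ, E) (fun y => S.coeff e i y (σ y)) x v : ℂ) • e i x := by
    intro i
    rw [S.dPrime_smul (hco i) (h.hol i x hx).isSmoothAt, ← S.D_eq_dPrime (h.hol i x hx),
      D_frame_of_tate h hx hss hT (hflat x), smul_zero, zero_add, delFun_of_hol (hcol i)]
  simp only [h1]
  rw [h.coeff_sum hx]

end CDVStructure
end LocalFrames

end

end TTStar

theorem corollary1p4 {E : Type*} [NormedAddCommGroup E] [NormedSpace ℂ E] [FiniteDimensional ℂ E]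
    {M : Type*} [TopologicalSpace M] [ChartedSpace E M] [IsManifold 𝓘(ℂ, E) ω M]
    [SimplyConnectedSpace M] (S : TTStar.CDVStructure E M) (hpos : S.IsPositive)
    (hss : S.IsSemisimple) :
    (S.DPrimeEqNabla → S.IsTate ∧ S.IsStronglyPotential) ∧
    ∀ (m : ℕ) (c : S.CanonicalCoordinates m),
      (S.DPrimeEqNabla ↔ S.IsTate ∧ c.IsFlat) ∧
      (S.DPrimeEqNabla →
        ∀ φ : ℂ → ∀ x : M, TTStar.HTan E x ≃ₗ[ℂ] TTStar.HTan E x,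
          S.IsPotential φ ↔
            ∃ k : Fin m → ℂ, (∀ i, k i ≠ 0) ∧ ∀ (z : ℂ) (x : M) (i : Fin m),
              φ z x (c.frame i x) = (k i * Complex.exp (z * conj (c.u x i))) • c.frame i x) := by
  have : Nonempty M := PathConnectedSpace.nonempty
  refine ⟨fun hDn => ⟨TTStar.CDVStructure.isTate_of_dPrimeEqNabla hpos hss hDn,
    TTStar.CDVStructure.isStronglyPotential_of_dPrimeEqNabla hpos hss hDn⟩, fun m c => ?_⟩
  have h := c.isIdempotentFrameOn hss
  refine ⟨⟨fun hDn => ⟨TTStar.CDVStructure.isTate_of_dPrimeEqNabla hpos hss hDn, fun i x =>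
    TTStar.CDVStructure.nabla_frame h (Set.mem_univ x) hpos hDn i⟩, fun hT =>
    TTStar.CDVStructure.dPrimeEqNabla_of_flat h hss hT.1 fun x i => hT.2 i x⟩, fun hDn φ => ?_⟩
  -- The canonical coordinates are the eigenvalues of `𝓤`, so the results for idempotent frames
  -- apply on all of `M`.
  simp only [← c.eig_eq hss]
  constructor
  · intro hP
    exact TTStar.CDVStructure.exists_potential_constants hpos hDn h hP hss
  · rintro ⟨k, -, hk⟩
    exact TTStar.CDVStructure.isPotential_of_frames hpos hDn fun x =>
      ⟨m, c.frame, Set.univ, k, h, Set.mem_univ x, fun z y _ i => hk z y i⟩
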